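/- **Setting.** A base station with $N_t$ antennas serves $M$ single-antenna users with channels $h_m\in\mathbb C^{N_t}$, noise powers $\sigma_m^2>0$ and SINR targets $\gamma_m>0$. For Hermitian matrices write $A\bullet B=\operatorname{tr}(AB)$. For $m,j\in\{1,\dots,M\}$ let $A_{mm}=\frac1{\gamma_m}h_mh_m^H$, $A_{mj}=-h_mh_m^H$ for $j\ne m$, $\tau_m=\sigma_m^2$, and let $\unrhd_m$ be $\ge$. For $i=M+1,\dots,M+L$ let $A_{ij}$ be arbitrary Hermitian matrices, $\tau_i\in\mathbb R$, and $\unrhd_i\in\{\le,=,\ge\}$. For $p=1,\dots,P$ and $m=1,\dots,M$ let $C_{pm}$ be Hermitian and $-\infty\le\ell_{pm}\le0\le\mu_{pm}\le\infty$. *Original SDP relaxation:* minimize $\sum_m\operatorname{tr}(X_m)$ over $X_m\succeq0$ subject to $$\sum_{j=1}^M A_{ij}\bullet X_j\unrhd_i\tau_i\ (i=1,\dots,M+L),\qquad \ell_{pm}\le C_{pm}\bullet X_m\le\mu_{pm}\ (\forall p,m).\tag{1}$$ *REEL-BF problem with $K\ge1$ beamformers per user:* minimize $\sum_m\operatorname{tr}(W_mW_m^H)$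 over $W_m=[w_{m,1},\dots,w_{m,K}]\in\mathbb C^{N_t\times K}$ such that $X_m=W_mW_m^H$ satisfies (1) and $h_m^Hw_{m,k}=0$ for $k=2,\dots,K$ and all $m$. Here $w_{m,1}$ is the information beamformer and the others are the shaping beamformers of user $m$. *Recovery.* Let $F_m$ be any matrix whose $N_t-1$ columns form an orthonormal basis of $h_m^\perp$, and let $U_m=[h_m/\|h_m\|,\ F_m]$. For a solution $\{X_m\}$ of the SDP write $U_m^HX_mU_m=\begin{bmatrix}\eta_m&\xi_m^H\\ \xi_m&\Gamma_m\end{bmatrix}$ with $\eta_m\in\mathbb R$. When $\eta_m>0$ and $\Omega_m\in\mathbb C^{(N_t-1)\times(K-1)}$ satisfies $\Omega_m\Omega_m^H=\Gamma_m-\xi_m\xi_m^H/\eta_m$, put $$W_m=U_m\begin{bmatrix}\sqrt{\eta_m}&0\\ \xi_m/\sqrt{\eta_m}&\Omega_m\end{bmatrix}.\tag{2}$$ *Rank reduction.* A rank reduction step replaces $X_m=V_mV_m^H$ ($V_m$ with $\operatorname{rank}X_m$ columns) by $V_m(I-\Delta_m)V_m^H$ for all $m$, where the $\Delta_m$ are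 Hermitian, $\sum_jA_{ij}\bullet V_j\Delta_jV_j^H=0$ for all $i$, the largest eigenvalue of all the $\Delta_m$ is $1$, and either (a) $C_{pm}\bullet V_m\Delta_mV_m^H=0$ for all $p,m$, or (b) every column $x$ of $V_m$ satisfies $x^HC_{pm}x=C_{pm}\bullet X_m/\operatorname{rank}X_m$ for all $p$, and the $\Delta_m$ are diagonal. **Theorem.** Suppose that the SDP relaxation is solvable, i.e. has a feasible point, and that one of the following holds: (i) $K\ge N_t$; (ii) $K\ge\sqrt{L+PM+1}+2$; (iii) $K\ge\min\{L+3,\ \sqrt{L+PM+1}+2\}$, $P=2$, and for all $p,m$ either $\ell_{pm}<C_{pm}\bullet X_m<\mu_{pm}$ at every optimal solution $\{X_m\}$ of the SDP, or $\ell_{pm}=0$ and moreover $\mu_{pm}=0$ or $C_{pm}\bullet X_m<\mu_{pm}$ at every optimal solution of the SDP (for instance $\mu_{pm}=\infty$). Then the SDP relaxation and the REEL-BF problem both attain their minima, and the two minima are equal. Moreover, from every optimal solution of the SDP one arrives, by at most $MN_t$ rank reduction steps (none in case (i)) through optimal solutions of the SDP, at an optimal solution $\{X_m\}$ from which an optimal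 REEL-BF design is recovered: matrices $F_m$ as above exist, and for every choice of them $\eta_m>0$ and $\operatorname{rank}(\Gamma_m-\xi_m\xi_m^H/\eta_m)\le K-1$ for all $m$, matrices $\Omega_m$ as above exist, and for every choice of them the matrices (2) solve the REEL-BF problem, have the same power $\sum_m\operatorname{tr}(W_mW_m^H)=\sum_m\operatorname{tr}(X_m)$, and give each user $m$ the SINR $$\frac{|h_m^Hw_{m,1}|^2}{\sum_{k\ge2}|h_m^Hw_{m,k}|^2+\sum_{j\ne m}\sum_{k}|h_m^Hw_{j,k}|^2+\sigma_m^2}\ \ge\ \gamma_m .$$ -/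

import Mathlib

open scoped Matrix ComplexOrder

namespace REELBF

/-- The relation of a linear constraint: one of `≤`, `=`, `≥`. -/
inductive Rel where
  | le
  | eq
  | ge

/-- `r.Holds a b` means `a ≤ b`, `a = b` or `a ≥ b`, according to `r`. -/
def Rel.Holds : Rel → ℝ → ℝ → Prop
  | .le, a, b => a ≤ b
  | .eq, a, b => a = b
  | .ge, a, b => b ≤ a

/-- The product `A • B = tr (A B)`. It is only used for Hermitian `A`, `B`, where the trace is a real
number (`trace_mul_im`), so taking the real part loses nothing. -/
noncomputable def ip {n : Type*} [Fintype n] (A B : Matrix n n ℂ) : ℝ :=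
  (A * B).trace.re

theorem trace_mul_im {n : Type*} [Fintype n] {A B : Matrix n n ℂ}
    (hA : A.IsHermitian) (hB : B.IsHermitian) : (A * B).trace.im = 0 := by
  have h : star (A * B).trace = (A * B).trace := by
    rw [← Matrix.trace_conjTranspose, Matrix.conjTranspose_mul, hA.eq, hB.eq, Matrix.trace_mul_comm]
  exact Complex.conj_eq_iff_im.mp h

/-- The data of a downlink beamforming problem with `N` transmit antennas, `M` users, `L` joint
shaping constraints and `P` groups of individual shaping constraints. The bounds of the individual
constraints are extended reals, so that one-sided constraints are included. -/
structure Downlink (N M L P : ℕ) where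
  /-- channel vectors: user `m` receives `(h m)ᴴ x` plus noise -/
  h : Fin M → Fin N → ℂ
  /-- SINR targets -/
  gamma : Fin M → ℝ
  gamma_pos : ∀ m, 0 < gamma m
  /-- noise standard deviations -/
  sigma : Fin M → ℝ
  sigma_pos : ∀ m, 0 < sigma m
  /-- matrices, relations and thresholds of the joint shaping constraints -/
  B : Fin L → Fin M → Matrix (Fin N) (Fin N) ℂ
  B_herm : ∀ i j, (B i j).IsHermitian
  rel : Fin L → Rel
  thr : Fin L → ℝ
  /-- matrices and bounds of the individual shaping constraints -/
  C : Fin P → Fin M → Matrix (Fin N) (Fin N) ℂ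
  C_herm : ∀ p m, (C p m).IsHermitian
  lower : Fin P → Fin M → EReal
  upper : Fin P → Fin M → EReal
  lower_nonpos : ∀ p m, lower p m ≤ 0
  upper_nonneg : ∀ p m, 0 ≤ upper p m

namespace Downlink

variable {N M L P : ℕ} (S : Downlink N M L P)

/-- The rank-one channel matrix `h_m h_mᴴ`. -/
def hh (m : Fin M) : Matrix (Fin N) (Fin N) ℂ :=
  Matrix.vecMulVec (S.h m) (star (S.h m))

/-- The coefficient matrices `A i j` of the `M + L` joint constraints. The first `M` of them encode
the SINR constraints, the other `L` are the joint shaping constraints. -/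
noncomputable def A : Fin M ⊕ Fin L → Fin M → Matrix (Fin N) (Fin N) ℂ
  | .inl m, j => if j = m then ((1 / S.gamma m : ℝ) : ℂ) • S.hh m else - S.hh m
  | .inr i, j => S.B i j

/-- The relations of the `M + L` joint constraints. -/
def jointRel : Fin M ⊕ Fin L → Rel
  | .inl _ => .ge
  | .inr i => S.rel i

/-- The thresholds of the `M + L` joint constraints. -/
noncomputable def tau : Fin M ⊕ Fin L → ℝ
  | .inl m => S.sigma m ^ 2
  | .inr i => S.thr i

/-- All joint and individual constraints, for the transmit covariance matrices `X m`. -/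
def Constraints (X : Fin M → Matrix (Fin N) (Fin N) ℂ) : Prop :=
  (∀ i, (S.jointRel i).Holds (∑ j, ip (S.A i j) (X j)) (S.tau i)) ∧
  (∀ p m, S.lower p m ≤ (ip (S.C p m) (X m) : EReal) ∧
    (ip (S.C p m) (X m) : EReal) ≤ S.upper p m)

/-- The transmission power of the covariance matrices `X m` (which are Hermitian). -/
noncomputable def power (X : Fin M → Matrix (Fin N) (Fin N) ℂ) : ℝ :=
  ∑ m, (X m).trace.re

/-! ### The original SDP relaxation -/

def SDPFeasible (X : Fin M → Matrix (Fin N) (Fin N) ℂ) : Prop :=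
  (∀ m, (X m).PosSemidef) ∧ S.Constraints X

def SDPOptimal (X : Fin M → Matrix (Fin N) (Fin N) ℂ) : Prop :=
  S.SDPFeasible X ∧ ∀ X', S.SDPFeasible X' → power X ≤ power X'

/-! ### The REEL-BF design with `K` beamformers per user

The beamforming matrix `W m` of user `m` has the column `Sum.inl ()`, the information beamformer, and
the `K - 1` columns `Sum.inr k`, the shaping beamformers. -/

/-- The covariance matrices `W_m W_mᴴ` (which are positive semidefinite, of rank at most `K`). -/
def cov {K : ℕ} (W : Fin M → Matrix (Fin N) (Unit ⊕ Fin (K - 1)) ℂ) :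
    Fin M → Matrix (Fin N) (Fin N) ℂ :=
  fun m => W m * (W m)ᴴ

/-- Feasibility in the REEL-BF problem: the joint and individual constraints hold, and every shaping
beamformer of user `m` is orthogonal to the channel of user `m`. -/
def REELFeasible (K : ℕ) (W : Fin M → Matrix (Fin N) (Unit ⊕ Fin (K - 1)) ℂ) : Prop :=
  S.Constraints (cov W) ∧
  ∀ m k, star (S.h m) ⬝ᵥ (W m).col (Sum.inr k) = 0

def REELOptimal (K : ℕ) (W : Fin M → Matrix (Fin N) (Unit ⊕ Fin (K - 1)) ℂ) : Prop :=
  S.REELFeasible K W ∧ ∀ W', S.REELFeasible K W' → power (cov W) ≤ power (cov W')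

/-- The SINR of user `m`: the power of its information signal over that of its own redundant
signals, all the signals of the other users, and the noise. -/
noncomputable def sinr {K : ℕ} (W : Fin M → Matrix (Fin N) (Unit ⊕ Fin (K - 1)) ℂ)
    (m : Fin M) : ℝ :=
  ‖star (S.h m) ⬝ᵥ (W m).col (Sum.inl ())‖ ^ 2 /
    (∑ k, ‖star (S.h m) ⬝ᵥ (W m).col (Sum.inr k)‖ ^ 2 +
      ∑ j ∈ Finset.univ.erase m, ∑ k, ‖star (S.h m) ⬝ᵥ (W j).col k‖ ^ 2 + S.sigma m ^ 2)

/-! ### Beamformers from an SDP solution: unitary rotation and Schur complement -/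

/-- The columns of `F m` are an orthonormal basis of the orthogonal complement of `h m`
(when `h m ≠ 0`). -/
def IsNullBasis (F : Fin M → Matrix (Fin N) (Fin (N - 1)) ℂ) : Prop :=
  ∀ m, (F m)ᴴ * F m = 1 ∧ ∀ k, star (S.h m) ⬝ᵥ (F m).col k = 0

/-- The channel direction `h_m / ‖h_m‖` (Euclidean norm), as a one-column matrix. -/
noncomputable def hbar (m : Fin M) : Matrix (Fin N) Unit ℂ :=
  Matrix.replicateCol Unit (((‖WithLp.toLp 2 (S.h m)‖⁻¹ : ℝ) : ℂ) • S.h m)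

/-- The rotation `U_m = [h_m / ‖h_m‖, F_m]`. -/
noncomputable def U (F : Fin M → Matrix (Fin N) (Fin (N - 1)) ℂ) (m : Fin M) :
    Matrix (Fin N) (Unit ⊕ Fin (N - 1)) ℂ :=
  Matrix.fromCols (S.hbar m) (F m)

/-- The rotated matrix `U_mᴴ X_m U_m`, with blocks `η` (`1 × 1`), `ξ` (first column) and `Γ`. -/
noncomputable def rot (F : Fin M → Matrix (Fin N) (Fin (N - 1)) ℂ)
    (X : Fin M → Matrix (Fin N) (Fin N) ℂ) (m : Fin M) :
    Matrix (Unit ⊕ Fin (N - 1)) (Unit ⊕ Fin (N - 1)) ℂ :=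
  (S.U F m)ᴴ * X m * S.U F m

noncomputable def eta (F : Fin M → Matrix (Fin N) (Fin (N - 1)) ℂ)
    (X : Fin M → Matrix (Fin N) (Fin N) ℂ) (m : Fin M) : ℝ :=
  (S.rot F X m (Sum.inl ()) (Sum.inl ())).re

noncomputable def xi (F : Fin M → Matrix (Fin N) (Fin (N - 1)) ℂ)
    (X : Fin M → Matrix (Fin N) (Fin N) ℂ) (m : Fin M) : Matrix (Fin (N - 1)) Unit ℂ :=
  (S.rot F X m).toBlocks₂₁

/-- The Schur complement `Γ - ξ ξᴴ / η`. -/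
noncomputable def schur (F : Fin M → Matrix (Fin N) (Fin (N - 1)) ℂ)
    (X : Fin M → Matrix (Fin N) (Fin N) ℂ) (m : Fin M) :
    Matrix (Fin (N - 1)) (Fin (N - 1)) ℂ :=
  (S.rot F X m).toBlocks₂₂ -
    (((S.eta F X m)⁻¹ : ℝ) : ℂ) • (S.xi F X m * (S.xi F X m)ᴴ)

/-- The beamforming matrices `U_m [α, 0; β, Ω]` with `α = √η` and `β = ξ / √η`. -/
noncomputable def beam {K : ℕ} (F : Fin M → Matrix (Fin N) (Fin (N - 1)) ℂ)
    (X : Fin M → Matrix (Fin N) (Fin N) ℂ)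
    (Om : Fin M → Matrix (Fin (N - 1)) (Fin (K - 1)) ℂ) (m : Fin M) :
    Matrix (Fin N) (Unit ⊕ Fin (K - 1)) ℂ :=
  S.U F m * Matrix.fromBlocks
    (Matrix.of fun _ _ => ((Real.sqrt (S.eta F X m) : ℝ) : ℂ)) 0
    ((((Real.sqrt (S.eta F X m))⁻¹ : ℝ) : ℂ) • S.xi F X m) (Om m)

/-- For every choice of orthonormal bases `F`, the rotation and the Schur-complement factorization
can be carried out on `X` with at most `K - 1` shaping beamformers, and each outcome is an optimal
REEL-BF design that meets the SINR targets with exactly the power of `X`. -/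
def Recovers (K : ℕ) (X : Fin M → Matrix (Fin N) (Fin N) ℂ) : Prop :=
  (∃ F, S.IsNullBasis F) ∧
  ∀ F, S.IsNullBasis F →
    (∀ m, 0 < S.eta F X m) ∧
    (∀ m, (S.schur F X m).rank ≤ K - 1) ∧
    (∃ Om : Fin M → Matrix (Fin (N - 1)) (Fin (K - 1)) ℂ,
      ∀ m, Om m * (Om m)ᴴ = S.schur F X m) ∧
    ∀ Om : Fin M → Matrix (Fin (N - 1)) (Fin (K - 1)) ℂ,
      (∀ m, Om m * (Om m)ᴴ = S.schur F X m) →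
        S.REELOptimal K (S.beam F X Om) ∧
        power (cov (S.beam F X Om)) = power X ∧
        ∀ m, S.gamma m ≤ S.sinr (S.beam F X Om) m

/-! ### Rank reduction of SDP solutions -/

/-- `X'_m = V_m (I - Δ_m) V_mᴴ`, where `X_m = V_m V_mᴴ` with `V_m` of full column rank, the Hermitian
matrices `Δ_m` are a solution of the homogeneous linear equations belonging to the joint
constraints, and their scale is such that the largest of their eigenvalues is `1`. -/
def IsUpdate (X X' : Fin M → Matrix (Fin N) (Fin N) ℂ)
    (V : ∀ m, Matrix (Fin N) (Fin (X m).rank) ℂ)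
    (D : ∀ m, Matrix (Fin (X m).rank) (Fin (X m).rank) ℂ) : Prop :=
  (∀ m, V m * (V m)ᴴ = X m) ∧
  (∀ m, (D m).IsHermitian) ∧
  (∀ i, ∑ j, ip (S.A i j) (V j * D j * (V j)ᴴ) = 0) ∧
  (∀ m, (1 - D m).PosSemidef) ∧ (∃ m, (1 - D m).det = 0) ∧
  ∀ m, X' m = V m * (1 - D m) * (V m)ᴴ

/-- A step of the general rank reduction procedure: the matrices `Δ_m` also solve the homogeneous
linear equations belonging to the individual constraints. -/
def GeneralStep (X X' : Fin M → Matrix (Fin N) (Fin N) ℂ) : Prop :=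
  ∃ V D, S.IsUpdate X X' V D ∧ ∀ p m, ip (S.C p m) (V m * D m * (V m)ᴴ) = 0

/-- A step of the rank reduction procedure with rank-one decomposition: the columns `x` of `V_m`
satisfy `xᴴ C_pm x = C_pm • X_m / rank X_m` for all `p`, and the matrices `Δ_m` are diagonal. -/
def RankOneStep (X X' : Fin M → Matrix (Fin N) (Fin N) ℂ) : Prop :=
  ∃ V D, S.IsUpdate X X' V D ∧
    (∀ p m k, ip (S.C p m) (Matrix.vecMulVec ((V m).col k) (star ((V m).col k))) =
      ip (S.C p m) (X m) / (X m).rank) ∧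
    ∀ m, (D m).IsDiag

/-- `X` is obtained from `X₀` by `n` rank reduction steps through SDP-optimal solutions. -/
def ReducesIn (n : ℕ) (X₀ X : Fin M → Matrix (Fin N) (Fin N) ℂ) : Prop :=
  ∃ Y : ℕ → Fin M → Matrix (Fin N) (Fin N) ℂ,
    Y 0 = X₀ ∧ Y n = X ∧ (∀ t ≤ n, S.SDPOptimal (Y t)) ∧
    ∀ t < n, S.GeneralStep (Y t) (Y (t + 1)) ∨ S.RankOneStep (Y t) (Y (t + 1))

/-- Every individual constraint is inactive at optimality (both bounds are strict at each optimal
solution), or it reduces to `C_pm • X_m = 0` or `C_pm • X_m ≥ 0` (the lower bound is `0`, and the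
upper bound is `0`, or it is infinite or at least never active at an optimal solution). -/
def InactiveOrHomogeneous : Prop :=
  ∀ p m,
    (∀ X, S.SDPOptimal X → S.lower p m < (ip (S.C p m) (X m) : EReal) ∧
      (ip (S.C p m) (X m) : EReal) < S.upper p m) ∨
    (S.lower p m = 0 ∧ (S.upper p m = 0 ∨
      ∀ X, S.SDPOptimal X → (ip (S.C p m) (X m) : EReal) < S.upper p m))

end Downlink

end REELBF

namespace REELBF

section NumericalRange

variable {E : Type*} [NormedAddCommGroup E] [InnerProductSpace ℂ E]

/-- A quadratic form which is real on the real plane spanned by `x` and `y` takes each value between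
`0` and `1` on the unit sphere if it takes these two. -/
theorem exists_unit_inner_eq_of_real_cross (T : E →ₗ[ℂ] E) (p : Submodule ℂ E) {x y : E}
    (hxp : x ∈ p) (hyp : y ∈ p) (hx : ‖x‖ = 1) (hy : ‖y‖ = 1) (hTx : inner ℂ x (T x) = 0)
    (hTy : inner ℂ y (T y) = 1) {g : ℝ} (hg : inner ℂ x (T y) + inner ℂ y (T x) = (g : ℂ))
    {t : ℝ} (ht : t ∈ Set.Icc (0 : ℝ) 1) : ∃ z ∈ p, ‖z‖ = 1 ∧ inner ℂ z (T z) = (t : ℂ) := by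
  let z : ℝ → E := fun s => ((1 - s : ℝ) : ℂ) • x + (s : ℂ) • y
  have hz0 : ∀ s ∈ Set.Icc (0 : ℝ) 1, z s ≠ 0 := by
    intro s hs h0
    have h1 : ((1 - s : ℝ) : ℂ) • x = -((s : ℂ) • y) := eq_neg_of_add_eq_zero_left h0
    have h2 : s = 1 / 2 := by
      have h3 := congrArg norm h1
      rw [norm_neg, norm_smul, norm_smul, hx, hy, Complex.norm_real, Complex.norm_real,
        Real.norm_of_nonneg (by linarith [hs.2]), Real.norm_of_nonneg hs.1] at h3
      linarith
    have h4 : x = -y := by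
      have h5 : ((1 / 2 : ℝ) : ℂ) • x = ((1 / 2 : ℝ) : ℂ) • (-y) := by
        rw [smul_neg, ← h2, ← h1, h2]; norm_num
      exact smul_right_injective E (by norm_num : ((1 / 2 : ℝ) : ℂ) ≠ 0) h5
    rw [h4] at hTx
    simp [hTy] at hTx
  have hq : ∀ s, inner ℂ (z s) (T (z s)) = ((s * (1 - s) * g + s ^ 2 : ℝ) : ℂ) := by
    intro s
    have : inner ℂ (z s) (T (z s)) =
        ((1 - s : ℝ) : ℂ) ^ 2 * inner ℂ x (T x) + (s : ℂ) * ((1 - s : ℝ) : ℂ) *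
          (inner ℂ x (T y) + inner ℂ y (T x)) + (s : ℂ) ^ 2 * inner ℂ y (T y) := by
      simp only [z, map_add, map_smul, inner_add_left, inner_add_right, inner_smul_left,
        inner_smul_right, Complex.conj_ofReal]
      ring
    rw [this, hTx, hTy, hg]
    push_cast
    ring
  let f : ℝ → ℝ := fun s => (s * (1 - s) * g + s ^ 2) / ‖z s‖ ^ 2
  have hf : ContinuousOn f (Set.Icc 0 1) := by
    apply ContinuousOn.div
    · fun_prop
    · fun_prop
    · intro s hs
      exact pow_ne_zero _ (norm_ne_zero_iff.mpr (hz0 s hs))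
  have hIVT := intermediate_value_Icc zero_le_one hf
  have hf0 : f 0 = 0 := by simp [f]
  have hf1 : f 1 = 1 := by simp [f, z, hy]
  rw [hf0, hf1] at hIVT
  obtain ⟨s, hs, hfs⟩ := hIVT ht
  have hn : ‖z s‖ ≠ 0 := norm_ne_zero_iff.mpr (hz0 s hs)
  refine ⟨((‖z s‖⁻¹ : ℝ) : ℂ) • z s, p.smul_mem _ (p.add_mem (p.smul_mem _ hxp)
    (p.smul_mem _ hyp)), ?_, ?_⟩
  · rw [norm_smul, Complex.norm_real, norm_inv, norm_norm, inv_mul_cancel₀ hn]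
  · rw [map_smul, inner_smul_left, inner_smul_right, hq, Complex.conj_ofReal, ← hfs]
    simp only [f]
    push_cast
    field_simp

/-- The **Toeplitz-Hausdorff theorem**: the numerical range of a linear operator, here compressed to
a subspace `p`, is convex. -/
theorem convex_numericalRange (T : E →ₗ[ℂ] E) (p : Submodule ℂ E) :
    Convex ℝ {c : ℂ | ∃ x ∈ p, ‖x‖ = 1 ∧ inner ℂ x (T x) = c} := by
  rw [convex_iff_segment_subset]
  rintro a ⟨x, hxp, hx, hTx⟩ b ⟨y, hyp, hy, hTy⟩ c hc
  rw [segment_eq_image_lineMap] at hc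
  obtain ⟨t, ht, rfl⟩ := hc
  by_cases hab : b - a = 0
  · have : a = b := (sub_eq_zero.mp hab).symm
    subst this
    exact ⟨x, hxp, hx, by simp [hTx]⟩
  let S : E →ₗ[ℂ] E := (b - a)⁻¹ • (T - a • LinearMap.id)
  have hS : ∀ u v : E, inner ℂ u (S v) = (b - a)⁻¹ * (inner ℂ u (T v) - a * inner ℂ u v) := by
    intro u v
    rw [LinearMap.smul_apply, inner_smul_right, LinearMap.sub_apply, inner_sub_right,
      LinearMap.smul_apply, LinearMap.id_apply, inner_smul_right]
  have hself : ∀ u : E, ‖u‖ = 1 → inner ℂ u u = 1 := by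
    intro u hu
    rw [inner_self_eq_norm_sq_to_K, hu]
    simp
  set al : ℂ := inner ℂ x (S y)
  set be : ℂ := inner ℂ y (S x)
  obtain ⟨c, hc1, hcr⟩ : ∃ c : ℂ, ‖c‖ = 1 ∧ (c * (al - starRingEnd ℂ be)).im = 0 := by
    by_cases h0 : al - starRingEnd ℂ be = 0
    · exact ⟨1, by simp, by simp [h0]⟩
    · set w := al - starRingEnd ℂ be
      have hw : ‖w‖ ≠ 0 := norm_ne_zero_iff.mpr h0
      refine ⟨starRingEnd ℂ w / (‖w‖ : ℂ), ?_, ?_⟩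
      · rw [norm_div, RCLike.norm_conj, Complex.norm_real, norm_norm, div_self hw]
      · rw [div_mul_eq_mul_div, mul_comm, Complex.mul_conj, ← Complex.ofReal_div]
        exact Complex.ofReal_im _
  have hcc : starRingEnd ℂ c * c = 1 := by
    rw [mul_comm, Complex.mul_conj, Complex.normSq_eq_norm_sq, hc1]
    simp
  have hcross : inner ℂ x (S (c • y)) + inner ℂ (c • y) (S x) =
      (((c * al + starRingEnd ℂ c * be).re : ℝ) : ℂ) := by
    rw [map_smul, inner_smul_right, inner_smul_left]
    change c * al + starRingEnd ℂ c * be = _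
    apply Complex.ext
    · simp
    · rw [Complex.ofReal_im]
      simp only [Complex.mul_im, Complex.add_im, Complex.conj_re, Complex.conj_im,
        Complex.sub_re, Complex.sub_im] at hcr ⊢
      linarith
  obtain ⟨z, hzp, hz, hSz⟩ := exists_unit_inner_eq_of_real_cross S p hxp (p.smul_mem c hyp) hx
    (by rw [norm_smul, hc1, hy, one_mul])
    (by rw [hS, hTx, hself x hx]; ring)
    (by
      rw [map_smul, inner_smul_left, inner_smul_right, ← mul_assoc, hcc, hS, hTy, hself y hy,
        one_mul, mul_one, inv_mul_cancel₀ hab]) hcross ht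
  refine ⟨z, hzp, hz, ?_⟩
  rw [hS, hself z hz] at hSz
  rw [AffineMap.lineMap_apply_module, Complex.real_smul, Complex.real_smul]
  field_simp at hSz
  push_cast
  linear_combination hSz

/-- A traceless operator has an orthonormal basis in which its diagonal vanishes. -/
theorem exists_orthonormalBasis_diag_eq_zero [FiniteDimensional ℂ E] {n : ℕ}
    (hn : Module.finrank ℂ E = n) (T : E →ₗ[ℂ] E) (hT : LinearMap.trace ℂ E T = 0) :
    ∃ b : OrthonormalBasis (Fin n) ℂ E, ∀ i, inner ℂ (b i) (T (b i)) = 0 := by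
  suffices h : ∀ k ≤ n, ∃ b : OrthonormalBasis (Fin n) ℂ E,
      ∀ i : Fin n, (i : ℕ) < k → inner ℂ (b i) (T (b i)) = 0 by
    obtain ⟨b, hb⟩ := h n le_rfl
    exact ⟨b, fun i => hb i i.2⟩
  intro k
  induction k with
  | zero => exact fun _ => ⟨(stdOrthonormalBasis ℂ E).reindex (finCongr hn), by simp⟩
  | succ k ih =>
    intro hk
    obtain ⟨b, hb⟩ := ih (by omega)
    let p : Submodule ℂ E := (Submodule.span ℂ (b '' {i | (i : ℕ) < k}))ᗮ
    have hp : ∀ x ∈ p, ∀ i : Fin n, (i : ℕ) < k → inner ℂ (b i) x = 0 := fun x hx i hi =>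
      Submodule.inner_right_of_mem_orthogonal (Submodule.subset_span (Set.mem_image_of_mem b hi)) hx
    have hbp : ∀ i : Fin n, k ≤ (i : ℕ) → b i ∈ p := by
      intro i hi
      rw [Submodule.mem_orthogonal]
      intro u hu
      induction hu using Submodule.span_induction with
      | mem u hu =>
        obtain ⟨j, hj, rfl⟩ := hu
        refine b.orthonormal.2 fun hji => ?_
        have : (j : ℕ) < k := hj
        rw [hji] at this
        omega
      | zero => simp
      | add u v _ _ hu hv => rw [inner_add_left, hu, hv, add_zero]
      | smul c u _ hu => rw [inner_smul_left, hu, mul_zero]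
    let s : Finset (Fin n) := Finset.univ.filter fun i => k ≤ (i : ℕ)
    have hsum : ∑ i ∈ s, inner ℂ (b i) (T (b i)) = 0 := by
      rw [← hT, LinearMap.trace_eq_sum_inner T b]
      refine Finset.sum_subset (Finset.subset_univ _) fun i _ hi => hb i ?_
      simpa [s] using hi
    have hks : (⟨k, by omega⟩ : Fin n) ∈ s := by simp [s]
    have hs : 0 < s.card := Finset.card_pos.mpr ⟨_, hks⟩
    have hmem : (0 : ℂ) ∈ {c : ℂ | ∃ x ∈ p, ‖x‖ = 1 ∧ inner ℂ x (T x) = c} := by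
      have h := (convex_numericalRange T p).sum_mem (t := s) (w := fun _ => (s.card : ℝ)⁻¹)
        (z := fun i => inner ℂ (b i) (T (b i))) (fun _ _ => by positivity)
        (by rw [Finset.sum_const, nsmul_eq_mul, mul_inv_cancel₀ (by positivity)])
        (fun i hi => ⟨b i, hbp i (by simpa [s] using hi), b.orthonormal.1 i, rfl⟩)
      rwa [← Finset.smul_sum, hsum, smul_zero] at h
    obtain ⟨x, hxp, hx, hTx⟩ := hmem
    let v : Fin n → E := fun i => if (i : ℕ) < k then b i else x
    have hv : Orthonormal ℂ (Set.domRestrict {i : Fin n | (i : ℕ) < k + 1} v) := by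
      constructor
      · rintro ⟨i, hi⟩
        by_cases hik : (i : ℕ) < k <;> simp [Set.domRestrict, v, hik, hx]
      · rintro ⟨i, hi⟩ ⟨j, hj⟩ hij
        have hij' : (i : ℕ) ≠ j := fun h => hij (Subtype.ext (Fin.ext h))
        simp only [Set.mem_ofPred_eq] at hi hj
        by_cases hik : (i : ℕ) < k <;> by_cases hjk : (j : ℕ) < k
        · simpa [Set.domRestrict, v, hik, hjk] using b.orthonormal.2 (fun h => hij' (congrArg _ h))
        · simpa [Set.domRestrict, v, hik, hjk] using hp x hxp i hik
        · simpa [Set.domRestrict, v, hik, hjk] using inner_eq_zero_symm.mp (hp x hxp j hjk)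
        · omega
    obtain ⟨b', hb'⟩ := hv.exists_orthonormalBasis_extension_of_card_eq (by simp [hn])
    refine ⟨b', fun i hi => ?_⟩
    rw [hb' i hi]
    by_cases hik : (i : ℕ) < k
    · simpa [v, hik] using hb i hik
    · simpa [v, hik] using hTx

end NumericalRange

/-- Every complex square matrix is unitarily similar to one with constant diagonal. -/
theorem exists_unitary_const_diag {n : ℕ} (G : Matrix (Fin n) (Fin n) ℂ) :
    ∃ Q : Matrix (Fin n) (Fin n) ℂ, Qᴴ * Q = 1 ∧ ∀ k, (Qᴴ * G * Q) k k = G.trace / n := by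
  let T : EuclideanSpace ℂ (Fin n) →ₗ[ℂ] EuclideanSpace ℂ (Fin n) :=
    Matrix.toEuclideanLin (G - (G.trace / n) • 1)
  have hin : ∀ x y : EuclideanSpace ℂ (Fin n), inner ℂ x y = star x.ofLp ⬝ᵥ y.ofLp := by
    intro x y
    rw [EuclideanSpace.inner_eq_star_dotProduct, dotProduct_comm]
  have hT : LinearMap.trace ℂ _ T = 0 := by
    rw [LinearMap.trace_eq_sum_inner T (EuclideanSpace.basisFun (Fin n) ℂ)]
    simp only [hin, T, Matrix.toLpLin_apply, EuclideanSpace.basisFun_apply]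
    rcases Nat.eq_zero_or_pos n with rfl | hn
    · simp
    have hn' : (n : ℂ) ≠ 0 := by exact_mod_cast hn.ne'
    have hst : ∀ i : Fin n, star (Pi.single i (1 : ℂ) : Fin n → ℂ) = Pi.single i (1 : ℂ) := by
      intro i
      rw [← Pi.single_star, star_one]
    simp [Matrix.trace, hst, mul_div_cancel₀ _ hn']
  obtain ⟨b, hb⟩ := exists_orthonormalBasis_diag_eq_zero finrank_euclideanSpace_fin T hT
  let Q : Matrix (Fin n) (Fin n) ℂ := Matrix.of fun i k => b k i
  have hQ : Qᴴ * Q = 1 := by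
    ext i j
    have := (orthonormal_iff_ite.mp b.orthonormal) i j
    rw [hin] at this
    rw [Matrix.one_apply, ← this]
    rfl
  refine ⟨Q, hQ, fun k => ?_⟩
  have h1 : (Qᴴ * (G - (G.trace / n) • 1) * Q) k k = 0 := by
    rw [← hb k, hin, Matrix.mul_assoc]
    rfl
  rw [Matrix.mul_sub, Matrix.sub_mul, Matrix.mul_smul, Matrix.smul_mul, Matrix.mul_one, hQ,
    Matrix.sub_apply, Matrix.smul_apply, Matrix.one_apply_eq, smul_eq_mul, mul_one] at h1
  exact sub_eq_zero.mp h1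

end REELBF

namespace REELBF

section Spectral

variable {n : Type*} [Fintype n] [DecidableEq n]

theorem exists_spectral_decomposition {A : Matrix n n ℂ} (hA : A.IsHermitian) :
    ∃ (U : Matrix n n ℂ) (d : n → ℝ), Uᴴ * U = 1 ∧ U * Uᴴ = 1 ∧
      A = U * Matrix.diagonal (fun i => (d i : ℂ)) * Uᴴ ∧
      A.rank = Fintype.card {i // d i ≠ 0} ∧ (A.PosSemidef → ∀ i, 0 ≤ d i) := by
  refine ⟨hA.eigenvectorUnitary, hA.eigenvalues, ?_, ?_, ?_, hA.rank_eq_card_non_zero_eigs,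
    fun h => h.eigenvalues_nonneg⟩
  · exact Unitary.coe_star_mul_self hA.eigenvectorUnitary
  · exact Unitary.coe_mul_star_self hA.eigenvectorUnitary
  · conv_lhs => rw [hA.spectral_theorem, Unitary.conjStarAlgAut_apply]
    rfl

theorem exists_eq_mul_conjTranspose_of_rank_le {A : Matrix n n ℂ} (hA : A.PosSemidef) {k : ℕ}
    (hk : A.rank ≤ k) : ∃ V : Matrix n (Fin k) ℂ, V * Vᴴ = A := by
  obtain ⟨U, d, -, -, hUd, hrank, hd⟩ := exists_spectral_decomposition hA.isHermitian
  obtain ⟨f⟩ : Nonempty ({i // d i ≠ 0} ↪ Fin k) :=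
    Function.Embedding.nonempty_of_card_le (by rwa [Fintype.card_fin, ← hrank])
  let P : Matrix {i // d i ≠ 0} (Fin k) ℂ := Matrix.of fun s j => if f s = j then 1 else 0
  have hP : P * Pᴴ = 1 := by
    ext s t
    simp [P, Matrix.mul_apply, Matrix.one_apply]
  let V : Matrix n {i // d i ≠ 0} ℂ := Matrix.of fun i s => U i s * (Real.sqrt (d s) : ℂ)
  have hV : V * Vᴴ = A := by
    ext i j
    have h1 : (V * Vᴴ) i j = ∑ s : {s // d s ≠ 0}, U i s * (d s : ℂ) * star (U j s) := by
      refine Finset.sum_congr rfl fun s _ => ?_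
      have hs : ((d s : ℝ) : ℂ) = (Real.sqrt (d s) : ℂ) * (Real.sqrt (d s) : ℂ) := by
        rw [← Complex.ofReal_mul, Real.mul_self_sqrt (hd hA s)]
      simp only [V, Matrix.of_apply, Matrix.conjTranspose_apply, star_mul', hs]
      simp only [Complex.star_def, Complex.conj_ofReal]
      ring
    rw [h1, hUd, Matrix.mul_apply]
    simp only [Matrix.mul_diagonal, Matrix.conjTranspose_apply]
    rw [← Finset.sum_subtype (Finset.univ.filter fun s => d s ≠ 0) (by simp)
      (fun s => U i s * (d s : ℂ) * star (U j s))]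
    refine Finset.sum_subset (Finset.subset_univ _) fun s _ hs => ?_
    have : d s = 0 := by simpa using hs
    simp [this]
  refine ⟨V * P, ?_⟩
  rw [Matrix.conjTranspose_mul, Matrix.mul_assoc, ← Matrix.mul_assoc P, hP, Matrix.one_mul, hV]

theorem one_sub_smul_eq_conj_diagonal {U : Matrix n n ℂ} (hU : U * Uᴴ = 1) (d : n → ℝ) (t : ℝ) :
    1 - (t : ℂ) • (U * Matrix.diagonal (fun i => (d i : ℂ)) * Uᴴ) =
      U * Matrix.diagonal (fun i => ((1 - t * d i : ℝ) : ℂ)) * Uᴴ := by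
  have : Matrix.diagonal (fun i => ((1 - t * d i : ℝ) : ℂ)) =
      1 - (t : ℂ) • Matrix.diagonal (fun i => (d i : ℂ)) := by
    ext i j
    by_cases hij : i = j
    · subst hij; simp
    · simp [hij]
  rw [this, Matrix.mul_sub, Matrix.sub_mul, Matrix.mul_one, hU, Matrix.mul_smul, Matrix.smul_mul]

theorem posSemidef_conj_diagonal (U : Matrix n n ℂ) {d : n → ℝ} (hd : ∀ i, 0 ≤ d i) :
    (U * Matrix.diagonal (fun i => (d i : ℂ)) * Uᴴ).PosSemidef :=
  Matrix.PosSemidef.mul_mul_conjTranspose_same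
    (Matrix.PosSemidef.diagonal fun i => by simpa using hd i) U

theorem eventually_posSemidef_one_sub_smul {D : Matrix n n ℂ} (hD : D.IsHermitian) :
    ∀ᶠ t : ℝ in nhds 0, (1 - (t : ℂ) • D).PosSemidef := by
  obtain ⟨U, d, -, hU, hUd, -⟩ := exists_spectral_decomposition hD
  have h : ∀ᶠ t : ℝ in nhds 0, ∀ i, 0 < 1 - t * d i := by
    rw [Filter.eventually_all]
    intro i
    have hc : Continuous fun t : ℝ => 1 - t * d i := by fun_prop
    exact hc.continuousAt.eventually_mem (isOpen_Ioi.mem_nhds (by simp))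
  filter_upwards [h] with t ht
  rw [hUd, one_sub_smul_eq_conj_diagonal hU]
  exact posSemidef_conj_diagonal U fun i => (ht i).le

end Spectral

theorem posSemidef_one_sub_smul {n : Type*} [DecidableEq n] {D : Matrix n n ℂ}
    (hD : (1 - D).PosSemidef) {t : ℝ} (ht0 : 0 ≤ t) (ht1 : t ≤ 1) : (1 - (t : ℂ) • D).PosSemidef := by
  have h : (1 : Matrix n n ℂ) - (t : ℂ) • D = ((1 - t : ℝ) : ℂ) • 1 + (t : ℂ) • (1 - D) := by
    rw [smul_sub, Complex.ofReal_sub, sub_smul, Complex.ofReal_one, one_smul]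
    abel
  rw [h]
  refine (Matrix.PosSemidef.one.smul ?_).add (hD.smul ?_)
  · exact_mod_cast sub_nonneg.mpr ht1
  · exact_mod_cast ht0

/-- A nonzero tuple of Hermitian matrices can be scaled so that its largest eigenvalue is `1`. -/
theorem exists_scaling {M : ℕ} {r : Fin M → ℕ} {D : ∀ m, Matrix (Fin (r m)) (Fin (r m)) ℂ}
    (hD : ∀ m, (D m).IsHermitian) (h0 : D ≠ 0) :
    ∃ c : ℝ, (∀ m, (1 - (c : ℂ) • D m).PosSemidef) ∧ ∃ m, (1 - (c : ℂ) • D m).det = 0 := by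
  choose U d _ hU hUd _ using fun m => exists_spectral_decomposition (hD m)
  obtain ⟨m₀, hm₀⟩ := Function.ne_iff.mp h0
  obtain ⟨i₀, hi₀⟩ : ∃ i, d m₀ i ≠ 0 := by
    by_contra! h
    apply hm₀
    rw [hUd m₀, funext h]
    simp
  obtain ⟨⟨m, i⟩, -, hmax⟩ := Finset.exists_max_image Finset.univ
    (fun s : Σ m, Fin (r m) => |d s.1 s.2|) ⟨⟨m₀, i₀⟩, Finset.mem_univ _⟩
  have hpos : 0 < |d m i| := (abs_pos.mpr hi₀).trans_le (hmax ⟨m₀, i₀⟩ (Finset.mem_univ _))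
  refine ⟨(d m i)⁻¹, fun m' => ?_, m, ?_⟩
  · rw [hUd m', one_sub_smul_eq_conj_diagonal (hU m')]
    refine posSemidef_conj_diagonal _ fun i' => sub_nonneg.mpr ((le_abs_self _).trans ?_)
    rw [abs_mul, abs_inv, inv_mul_le_iff₀ hpos, mul_one]
    exact hmax ⟨m', i'⟩ (Finset.mem_univ _)
  · rw [hUd m, one_sub_smul_eq_conj_diagonal (hU m), Matrix.det_mul, Matrix.det_mul,
      Matrix.det_diagonal, Finset.prod_eq_zero (Finset.mem_univ i), mul_zero, zero_mul]
    rw [inv_mul_cancel₀ (abs_pos.mp hpos)]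
    simp

section Kernel

variable {M : ℕ} {r : Fin M → ℕ} {ι : Type*} [Fintype ι]

theorem exists_ne_zero_map_eq_zero {κ E : Type*} [Fintype κ] [AddCommGroup E] [Module ℝ E]
    (H : (κ → ℝ) →ₗ[ℝ] E) (hH : Function.Injective H) (Φ : E →ₗ[ℝ] ι → ℝ)
    (hcard : Fintype.card ι < Fintype.card κ) : ∃ y, H y ≠ 0 ∧ Φ (H y) = 0 := by
  have hker : LinearMap.ker (Φ ∘ₗ H) ≠ ⊥ :=
    LinearMap.ker_ne_bot_of_finrank_lt (by simpa using hcard)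
  obtain ⟨y, hy, hy0⟩ := Submodule.exists_mem_ne_zero_of_ne_bot hker
  exact ⟨y, fun h => hy0 (hH (h.trans (map_zero H).symm)), hy⟩

/-- A homogeneous system of fewer than `∑ (r m)²` real linear equations has a nonzero Hermitian
solution. -/
theorem exists_hermitian_map_eq_zero
    (Φ : (∀ m, Matrix (Fin (r m)) (Fin (r m)) ℂ) →ₗ[ℝ] ι → ℝ)
    (hcard : Fintype.card ι < ∑ m, r m ^ 2) :
    ∃ D, (∀ m, (D m).IsHermitian) ∧ D ≠ 0 ∧ Φ D = 0 := by
  let H : ((Σ m, Fin (r m) × Fin (r m)) → ℝ) →ₗ[ℝ] ∀ m, Matrix (Fin (r m)) (Fin (r m)) ℂ :=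
    { toFun := fun y m => Matrix.of fun i j =>
        ⟨y ⟨m, (i, j)⟩ + y ⟨m, (j, i)⟩, y ⟨m, (i, j)⟩ - y ⟨m, (j, i)⟩⟩
      map_add' := fun x y => by
        ext m i j
        apply Complex.ext <;> simp <;> ring
      map_smul' := fun c y => by
        ext m i j
        apply Complex.ext <;> simp <;> ring }
  have hH : Function.Injective H := by
    rw [injective_iff_map_eq_zero]
    intro y hy
    ext ⟨m, i, j⟩
    have h := congrFun (congrFun (congrFun hy m) i) j
    have h1 : y ⟨m, (i, j)⟩ + y ⟨m, (j, i)⟩ = 0 := congrArg Complex.re h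
    have h2 : y ⟨m, (i, j)⟩ - y ⟨m, (j, i)⟩ = 0 := congrArg Complex.im h
    change y ⟨m, (i, j)⟩ = 0
    linarith
  obtain ⟨y, hy0, hy⟩ := exists_ne_zero_map_eq_zero H hH Φ (by simpa [sq] using hcard)
  refine ⟨H y, fun m => ?_, hy0, hy⟩
  ext i j
  apply Complex.ext
  · exact add_comm _ _
  · exact neg_sub _ _

/-- A homogeneous system of fewer than `∑ r m` real linear equations has a nonzero real diagonal
solution. -/
theorem exists_diagonal_map_eq_zero
    (Φ : (∀ m, Matrix (Fin (r m)) (Fin (r m)) ℂ) →ₗ[ℝ] ι → ℝ)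
    (hcard : Fintype.card ι < ∑ m, r m) :
    ∃ d : ∀ m, Fin (r m) → ℝ, (fun m => Matrix.diagonal fun i => (d m i : ℂ)) ≠
      (0 : ∀ m, Matrix (Fin (r m)) (Fin (r m)) ℂ) ∧
      Φ (fun m => Matrix.diagonal fun i => (d m i : ℂ)) = 0 := by
  let H : ((Σ m, Fin (r m)) → ℝ) →ₗ[ℝ] ∀ m, Matrix (Fin (r m)) (Fin (r m)) ℂ :=
    { toFun := fun y m => Matrix.diagonal fun i => (y ⟨m, i⟩ : ℂ)
      map_add' := fun x y => by
        ext m i j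
        by_cases hij : i = j
        · subst hij; simp
        · simp [hij]
      map_smul' := fun c y => by
        ext m i j
        by_cases hij : i = j
        · subst hij; simp
        · simp [hij] }
  have hH : Function.Injective H := by
    rw [injective_iff_map_eq_zero]
    intro y hy
    ext ⟨m, i⟩
    have h := congrFun (congrFun (congrFun hy m) i) i
    simpa [H] using h
  obtain ⟨y, hy0, hy⟩ := exists_ne_zero_map_eq_zero H hH Φ (by simpa using hcard)
  exact ⟨fun m i => y ⟨m, i⟩, hy0, hy⟩

end Kernel

section InnerProduct

variable {n : Type*} [Fintype n]

theorem ip_sub (A B C : Matrix n n ℂ) : ip A (B - C) = ip A B - ip A C := by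
  simp [ip, Matrix.mul_sub]

theorem ip_smul (A B : Matrix n n ℂ) (t : ℝ) : ip A ((t : ℂ) • B) = t * ip A B := by
  simp [ip]

theorem continuous_ip (A : Matrix n n ℂ) : Continuous fun B => ip A B :=
  Complex.continuous_re.comp (continuous_const.matrix_mul continuous_id).matrix_trace

theorem ip_vecMulVec_self (A : Matrix n n ℂ) (x : n → ℂ) :
    ip A (Matrix.vecMulVec x (star x)) = (star x ⬝ᵥ A *ᵥ x).re := by
  rw [ip, Matrix.mul_vecMulVec, Matrix.trace_vecMulVec, dotProduct_comm]

theorem ip_vecMulVec_mul_conjTranspose {k : Type*} [Fintype k] (h : n → ℂ) (W : Matrix n k ℂ) :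
    ip (Matrix.vecMulVec h (star h)) (W * Wᴴ) = ∑ j, ‖star h ⬝ᵥ W.col j‖ ^ 2 := by
  have h1 : (Matrix.vecMulVec h (star h) * (W * Wᴴ)).trace =
      (Matrix.vecMulVec (Wᴴ *ᵥ h) (star h ᵥ* W)).trace := by
    rw [← Matrix.mul_assoc, Matrix.trace_mul_comm, Matrix.vecMulVec_mul, Matrix.mul_vecMulVec]
  rw [ip, h1, Matrix.trace_vecMulVec, dotProduct, Complex.re_sum]
  refine Finset.sum_congr rfl fun j _ => ?_
  have h2 : (Wᴴ *ᵥ h) j = star ((star h ᵥ* W) j) := by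
    rw [← Pi.star_apply, Matrix.star_vecMul, star_star]
  rw [h2, Complex.star_def, ← Complex.normSq_eq_conj_mul_self, Complex.ofReal_re,
    Complex.normSq_eq_norm_sq]
  rfl

/-- The real-linear map which evaluates the equations with coefficients `A i j` at the matrices
`V j * D j * (V j)ᴴ`. -/
noncomputable def congruenceMap {M : ℕ} {r : Fin M → ℕ} {ι : Type*}
    (A : ι → Fin M → Matrix n n ℂ) (V : ∀ m, Matrix n (Fin (r m)) ℂ) :
    (∀ m, Matrix (Fin (r m)) (Fin (r m)) ℂ) →ₗ[ℝ] ι → ℝ where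
  toFun D i := ∑ j, ip (A i j) (V j * D j * (V j)ᴴ)
  map_add' D E := by
    ext i
    simp [ip, Matrix.mul_add, Matrix.add_mul, Finset.sum_add_distrib]
  map_smul' c D := by
    ext i
    simp [ip, Finset.mul_sum]

/-- Rank-one decomposition with respect to two Hermitian matrices: the columns of a factor `V` of
`V * Vᴴ` can be chosen to contribute equally to both inner products. -/
theorem exists_rankOne_decomposition {k : ℕ} {C : Fin 2 → Matrix n n ℂ}
    (hC : ∀ p, (C p).IsHermitian) (V : Matrix n (Fin k) ℂ) :
    ∃ V' : Matrix n (Fin k) ℂ, V' * V'ᴴ = V * Vᴴ ∧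
      ∀ p i, ip (C p) (Matrix.vecMulVec (V'.col i) (star (V'.col i))) =
        ip (C p) (V * Vᴴ) / k := by
  let G : Fin 2 → Matrix (Fin k) (Fin k) ℂ := fun p => Vᴴ * C p * V
  have hG : ∀ p, (G p).IsHermitian := fun p => Matrix.isHermitian_conjTranspose_mul_mul V (hC p)
  obtain ⟨Q, hQ, hdiag⟩ := exists_unitary_const_diag (G 0 + Complex.I • G 1)
  have hherm : ∀ p i, ((Qᴴ * G p * Q) i i).im = 0 := fun p i =>
    Complex.conj_eq_iff_im.mp ((Matrix.isHermitian_conjTranspose_mul_mul Q (hG p)).apply i i)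
  have htr : ∀ p, (G p).trace = (ip (C p) (V * Vᴴ) : ℂ) := by
    intro p
    have h1 : (G p).trace = (C p * (V * Vᴴ)).trace := by
      rw [← Matrix.mul_assoc, Matrix.trace_mul_comm (C p * V), ← Matrix.mul_assoc]
    rw [h1]
    refine Complex.ext rfl ?_
    rw [trace_mul_im (hC p) (Matrix.isHermitian_mul_conjTranspose_self V)]
    simp
  have hre : ∀ p i, ((Qᴴ * G p * Q) i i).re = ip (C p) (V * Vᴴ) / k := by
    intro p i
    have h := hdiag i
    rw [Matrix.mul_add, Matrix.add_mul, Matrix.mul_smul, Matrix.smul_mul, Matrix.add_apply,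
      Matrix.smul_apply, Matrix.trace_add, Matrix.trace_smul, htr, htr, ← Complex.ofReal_natCast]
      at h
    have h0 := congrArg Complex.re h
    have h1 := congrArg Complex.im h
    simp only [smul_eq_mul, Complex.add_re, Complex.add_im, Complex.I_mul_re, Complex.I_mul_im,
      Complex.div_ofReal_re, Complex.div_ofReal_im, Complex.ofReal_re, Complex.ofReal_im, hherm]
      at h0 h1
    fin_cases p
    · simpa using h0
    · simpa using h1
  have hQ' : Q * Qᴴ = 1 := mul_eq_one_comm.mp hQ
  refine ⟨V * Q, ?_, fun p i => ?_⟩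
  · rw [Matrix.conjTranspose_mul, Matrix.mul_assoc, ← Matrix.mul_assoc Q, hQ', Matrix.one_mul]
  · rw [← hre p i, ip_vecMulVec_self]
    congr 1
    simp only [G]
    have : Qᴴ * (Vᴴ * C p * V) * Q = (V * Q)ᴴ * (C p * (V * Q)) := by
      rw [Matrix.conjTranspose_mul]
      simp only [Matrix.mul_assoc]
    rw [this]
    rfl

end InnerProduct

end REELBF

namespace REELBF

theorem re_mul_conjTranspose_apply_self {n k : Type*} [Fintype k] (V : Matrix n k ℂ) (i : n) :
    ((V * Vᴴ) i i).re = ∑ s, ‖V i s‖ ^ 2 := by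
  rw [Matrix.mul_apply, Complex.re_sum]
  refine Finset.sum_congr rfl fun s _ => ?_
  rw [Matrix.conjTranspose_apply, Complex.star_def, Complex.mul_conj, Complex.ofReal_re,
    Complex.normSq_eq_norm_sq]

theorem norm_apply_le_trace {n : Type*} [Fintype n] [DecidableEq n] {A : Matrix n n ℂ}
    (hA : A.PosSemidef) (i j : n) : ‖A i j‖ ≤ A.trace.re := by
  obtain ⟨V, hV⟩ := exists_eq_mul_conjTranspose_of_rank_le hA le_rfl
  rw [← hV]
  have htr : ∀ i, ∑ s, ‖V i s‖ ^ 2 ≤ (V * Vᴴ).trace.re := by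
    intro i
    rw [Matrix.trace, Complex.re_sum]
    simp only [Matrix.diag_apply, re_mul_conjTranspose_apply_self]
    exact Finset.single_le_sum (f := fun i => ∑ s, ‖V i s‖ ^ 2) (fun _ _ => by positivity)
      (Finset.mem_univ i)
  have h1 : ‖(V * Vᴴ) i j‖ ≤ ∑ s, (‖V i s‖ ^ 2 + ‖V j s‖ ^ 2) / 2 := by
    rw [Matrix.mul_apply]
    refine (norm_sum_le _ _).trans (Finset.sum_le_sum fun s _ => ?_)
    rw [norm_mul, Matrix.conjTranspose_apply, norm_star]
    linarith [two_mul_le_add_sq ‖V i s‖ ‖V j s‖]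
  rw [← Finset.sum_div, Finset.sum_add_distrib] at h1
  linarith [htr i, htr j]

theorem isClosed_posSemidef (n : Type*) [Fintype n] :
    IsClosed {A : Matrix n n ℂ | A.PosSemidef} := by
  have h : {A : Matrix n n ℂ | A.PosSemidef} =
      {A | Aᴴ = A} ∩ ⋂ x : n → ℂ, {A | 0 ≤ star x ⬝ᵥ A *ᵥ x} := by
    ext A
    simp [Matrix.posSemidef_iff_dotProduct_mulVec, Matrix.IsHermitian]
  rw [h]
  refine (isClosed_eq continuous_id.matrix_conjTranspose continuous_id).inter
    (isClosed_iInter fun x => isClosed_le continuous_const ?_)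
  exact continuous_const.dotProduct (continuous_id.matrix_mulVec continuous_const)

theorem Rel.isClosed_holds (r : Rel) (b : ℝ) : IsClosed {a | r.Holds a b} := by
  cases r
  · exact isClosed_Iic
  · exact isClosed_singleton
  · exact isClosed_Ici

theorem ip_comm {n : Type*} [Fintype n] (A B : Matrix n n ℂ) : ip A B = ip B A := by
  rw [ip, ip, Matrix.trace_mul_comm]

/-- The orthogonal complement of a nonzero vector has an orthonormal basis. -/
theorem exists_orthonormal_complement {N : ℕ} {h : Fin N → ℂ} (hh : h ≠ 0) :
    ∃ F : Matrix (Fin N) (Fin (N - 1)) ℂ, Fᴴ * F = 1 ∧ ∀ k, star h ⬝ᵥ F.col k = 0 := by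
  have hN : N ≠ 0 := by
    rintro rfl
    exact hh (Subsingleton.elim _ _)
  obtain ⟨n, rfl⟩ := Nat.exists_eq_succ_of_ne_zero hN
  let v : EuclideanSpace ℂ (Fin (n + 1)) := WithLp.toLp 2 h
  have hv : v ≠ 0 := fun h0 => hh (congrArg WithLp.ofLp h0)
  have : Fact (Module.finrank ℂ (EuclideanSpace ℂ (Fin (n + 1))) = n + 1) := ⟨by simp⟩
  let b := (stdOrthonormalBasis ℂ (Submodule.span ℂ {v})ᗮ).reindex
    (finCongr (Submodule.finrank_orthogonal_span_singleton (n := n) hv))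
  have hin : ∀ x y : EuclideanSpace ℂ (Fin (n + 1)), inner ℂ x y = star x.ofLp ⬝ᵥ y.ofLp := by
    intro x y
    rw [EuclideanSpace.inner_eq_star_dotProduct, dotProduct_comm]
  refine ⟨Matrix.of fun i k => (b k : EuclideanSpace ℂ (Fin (n + 1))) i, ?_, fun k => ?_⟩
  · ext i j
    have := (orthonormal_iff_ite.mp b.orthonormal) i j
    rw [Submodule.coe_inner, hin] at this
    rw [Matrix.one_apply, ← this]
    rfl
  · have := Submodule.inner_right_of_mem_orthogonal (Submodule.mem_span_singleton_self v) (b k).2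
    rwa [hin] at this

namespace Downlink

variable {N M L P : ℕ} (S : Downlink N M L P)

theorem isClosed_sdpFeasible : IsClosed {X | S.SDPFeasible X} := by
  simp only [SDPFeasible, Constraints, Set.ofPred_and, Set.ofPred_forall]
  refine (isClosed_iInter fun m => (isClosed_posSemidef (Fin N)).preimage (continuous_apply m)).inter
    ((isClosed_iInter fun i => ?_).inter (isClosed_iInter fun p => isClosed_iInter fun m => ?_))
  · exact (Rel.isClosed_holds _ _).preimage (continuous_finsetSum _ fun j _ =>
      (continuous_ip _).comp (continuous_apply j))
  · have hc : Continuous fun X : Fin M → Matrix (Fin N) (Fin N) ℂ =>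
        (ip (S.C p m) (X m) : EReal) :=
      continuous_coe_real_ereal.comp ((continuous_ip _).comp (continuous_apply m))
    exact (isClosed_le continuous_const hc).inter (isClosed_le hc continuous_const)

theorem continuous_power :
    Continuous (power : (Fin M → Matrix (Fin N) (Fin N) ℂ) → ℝ) :=
  continuous_finsetSum _ fun m _ => Complex.continuous_re.comp (continuous_apply m).matrix_trace

theorem trace_le_power {X : Fin M → Matrix (Fin N) (Fin N) ℂ} (hX : ∀ m, (X m).PosSemidef)
    (m : Fin M) : (X m).trace.re ≤ power X :=
  Finset.single_le_sum (f := fun m => (X m).trace.re)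
    (fun m _ => (Complex.nonneg_iff.mp (hX m).trace_nonneg).1) (Finset.mem_univ m)

theorem exists_sdpOptimal (h : ∃ X, S.SDPFeasible X) : ∃ X, S.SDPOptimal X := by
  obtain ⟨X₀, hX₀⟩ := h
  let R := power X₀
  have hbox : IsCompact (Set.pi Set.univ fun _ : Fin M =>
      (Set.pi Set.univ fun _ : Fin N => Set.pi Set.univ fun _ : Fin N =>
        Metric.closedBall (0 : ℂ) R : Set (Matrix (Fin N) (Fin N) ℂ))) :=
    isCompact_univ_pi fun _ => isCompact_univ_pi fun _ => isCompact_univ_pi fun _ =>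
      isCompact_closedBall _ _
  have hcomp : IsCompact ({X | S.SDPFeasible X} ∩ {X | power X ≤ R}) := by
    refine hbox.of_isClosed_subset
      (S.isClosed_sdpFeasible.inter (isClosed_le continuous_power continuous_const)) ?_
    rintro X ⟨hX, hXR⟩ m - i - j -
    rw [mem_closedBall_zero_iff]
    exact (norm_apply_le_trace (hX.1 m) i j).trans ((trace_le_power hX.1 m).trans hXR)
  obtain ⟨X, ⟨hX, -⟩, hmin⟩ :=
    hcomp.exists_isMinOn ⟨X₀, hX₀, le_refl R⟩ continuous_power.continuousOn
  refine ⟨X, hX, fun X' hX' => ?_⟩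
  rcases le_total (power X') R with h | h
  · exact hmin ⟨hX', h⟩
  · exact (hmin ⟨hX₀, le_refl R⟩).trans h

theorem sum_ip_A_inl (X : Fin M → Matrix (Fin N) (Fin N) ℂ) (m : Fin M) :
    ∑ j, ip (S.A (.inl m) j) (X j) =
      1 / S.gamma m * ip (S.hh m) (X m) - ∑ j ∈ Finset.univ.erase m, ip (S.hh m) (X j) := by
  rw [← Finset.add_sum_erase _ _ (Finset.mem_univ m), sub_eq_add_neg, ← Finset.sum_neg_distrib]
  congr 1
  · simp [A, ip]
  · refine Finset.sum_congr rfl fun j hj => ?_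
    simp [A, ip, Finset.ne_of_mem_erase hj]

theorem ip_hh_nonneg {X : Matrix (Fin N) (Fin N) ℂ} (hX : X.PosSemidef) (m : Fin M) :
    0 ≤ ip (S.hh m) X := by
  rw [ip_comm, hh, ip_vecMulVec_self]
  exact hX.re_dotProduct_nonneg _

variable {S}

theorem SDPFeasible.ip_hh_pos {X : Fin M → Matrix (Fin N) (Fin N) ℂ} (hX : S.SDPFeasible X)
    (m : Fin M) : 0 < ip (S.hh m) (X m) := by
  have h : S.sigma m ^ 2 ≤ _ := hX.2.1 (.inl m)
  rw [sum_ip_A_inl] at h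
  have h1 : 0 ≤ ∑ j ∈ Finset.univ.erase m, ip (S.hh m) (X j) :=
    Finset.sum_nonneg fun j _ => S.ip_hh_nonneg (hX.1 j) m
  have h2 : 0 < 1 / S.gamma m * ip (S.hh m) (X m) := by
    linarith [pow_pos (S.sigma_pos m) 2]
  exact (pos_iff_pos_of_mul_pos h2).mp (one_div_pos.mpr (S.gamma_pos m))

theorem SDPFeasible.h_ne_zero {X : Fin M → Matrix (Fin N) (Fin N) ℂ} (hX : S.SDPFeasible X)
    (m : Fin M) : S.h m ≠ 0 := by
  intro h
  have := hX.ip_hh_pos m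
  simp [hh, h, ip] at this

theorem SDPFeasible.rank_pos {X : Fin M → Matrix (Fin N) (Fin N) ℂ} (hX : S.SDPFeasible X)
    (m : Fin M) : 1 ≤ (X m).rank := by
  rw [Nat.one_le_iff_ne_zero]
  intro h0
  obtain ⟨V, hV⟩ := exists_eq_mul_conjTranspose_of_rank_le (hX.1 m) h0.le
  have h : X m = 0 := by
    rw [← hV]
    ext i j
    simp [Matrix.mul_apply]
  have := hX.ip_hh_pos m
  simp [h, ip] at this

theorem REELFeasible.sdpFeasible {K : ℕ} {W : Fin M → Matrix (Fin N) (Unit ⊕ Fin (K - 1)) ℂ}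
    (hW : S.REELFeasible K W) : S.SDPFeasible (cov W) :=
  ⟨fun m => Matrix.posSemidef_self_mul_conjTranspose (W m), hW.1⟩

theorem REELFeasible.gamma_le_sinr {K : ℕ}
    {W : Fin M → Matrix (Fin N) (Unit ⊕ Fin (K - 1)) ℂ} (hW : S.REELFeasible K W) (m : Fin M) :
    S.gamma m ≤ S.sinr W m := by
  have h : S.sigma m ^ 2 ≤ _ := hW.1.1 (.inl m)
  rw [sum_ip_A_inl] at h
  simp only [hh, cov, ip_vecMulVec_mul_conjTranspose] at h
  rw [Fintype.sum_sum_type] at h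
  have h0 : ∑ k, ‖star (S.h m) ⬝ᵥ (W m).col (Sum.inr k)‖ ^ 2 = 0 :=
    Finset.sum_eq_zero fun k _ => by simp [hW.2 m k]
  rw [h0, add_zero, Fintype.sum_unique, one_div_mul_eq_div, le_sub_iff_add_le,
    le_div_iff₀ (S.gamma_pos m)] at h
  have hσ := pow_pos (S.sigma_pos m) 2
  have hnn : 0 ≤ ∑ j ∈ Finset.univ.erase m, ∑ k, ‖star (S.h m) ⬝ᵥ (W j).col k‖ ^ 2 :=
    Finset.sum_nonneg fun j _ => Finset.sum_nonneg fun k _ => sq_nonneg _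
  rw [sinr, h0, zero_add, le_div_iff₀ (by linarith), mul_comm, add_comm]
  exact h

section Recovery

variable {F : Fin M → Matrix (Fin N) (Fin (N - 1)) ℂ} {X : Fin M → Matrix (Fin N) (Fin N) ℂ}
  {m : Fin M}

theorem U_col_inl (S : Downlink N M L P) (F : Fin M → Matrix (Fin N) (Fin (N - 1)) ℂ)
    (m : Fin M) : (S.U F m).col (Sum.inl ()) =
      ((‖WithLp.toLp 2 (S.h m)‖⁻¹ : ℝ) : ℂ) • S.h m := rfl

theorem eta_eq (S : Downlink N M L P) (F : Fin M → Matrix (Fin N) (Fin (N - 1)) ℂ)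
    (X : Fin M → Matrix (Fin N) (Fin N) ℂ) (m : Fin M) :
    S.eta F X m = (‖WithLp.toLp 2 (S.h m)‖⁻¹) ^ 2 * ip (S.hh m) (X m) := by
  have h : S.rot F X m (.inl ()) (.inl ()) =
      star ((S.U F m).col (.inl ())) ⬝ᵥ X m *ᵥ (S.U F m).col (.inl ()) := by
    rw [rot, Matrix.mul_assoc]
    rfl
  rw [eta, h, U_col_inl, ip_comm, hh, ip_vecMulVec_self, star_smul, Matrix.mulVec_smul,
    dotProduct_smul, smul_dotProduct, Complex.star_def, Complex.conj_ofReal, smul_eq_mul,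
    smul_eq_mul, ← mul_assoc, ← Complex.ofReal_mul, Complex.re_ofReal_mul, sq]

theorem IsNullBasis.conjTranspose_U_mul_U (hF : S.IsNullBasis F) (hm : S.h m ≠ 0) :
    (S.U F m)ᴴ * S.U F m = 1 := by
  obtain ⟨hF1, hF2⟩ := hF m
  have h12 : (S.hbar m)ᴴ * F m = 0 := by
    ext i k
    have : ((S.hbar m)ᴴ * F m) i k =
        star (((‖WithLp.toLp 2 (S.h m)‖⁻¹ : ℝ) : ℂ) • S.h m) ⬝ᵥ (F m).col k := rfl
    rw [this, star_smul, smul_dotProduct, hF2 k, smul_zero, Matrix.zero_apply]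
  have h11 : (S.hbar m)ᴴ * S.hbar m = 1 := by
    ext i j
    have h1 : ((S.hbar m)ᴴ * S.hbar m) i j =
        star (((‖WithLp.toLp 2 (S.h m)‖⁻¹ : ℝ) : ℂ) • S.h m) ⬝ᵥ
          (((‖WithLp.toLp 2 (S.h m)‖⁻¹ : ℝ) : ℂ) • S.h m) := rfl
    have h2 : star (S.h m) ⬝ᵥ S.h m = ((‖WithLp.toLp 2 (S.h m)‖ ^ 2 : ℝ) : ℂ) := by
      have := inner_self_eq_norm_sq_to_K (𝕜 := ℂ) (WithLp.toLp 2 (S.h m))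
      rw [EuclideanSpace.inner_eq_star_dotProduct, dotProduct_comm] at this
      rw [Complex.ofReal_pow]
      exact this
    have h3 : ‖WithLp.toLp 2 (S.h m)‖ ≠ 0 := by
      rw [norm_ne_zero_iff]
      exact fun h => hm (congrArg WithLp.ofLp h)
    rw [h1, star_smul, smul_dotProduct, dotProduct_smul, h2, Complex.star_def,
      Complex.conj_ofReal, smul_eq_mul, smul_eq_mul, Subsingleton.elim i j, Matrix.one_apply_eq]
    have h4 : ((‖WithLp.toLp 2 (S.h m)‖ : ℝ) : ℂ) ≠ 0 := by exact_mod_cast h3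
    push_cast
    field_simp
  have h21 : (F m)ᴴ * S.hbar m = 0 := by
    rw [← Matrix.conjTranspose_conjTranspose (S.hbar m), ← Matrix.conjTranspose_mul, h12,
      Matrix.conjTranspose_zero]
  rw [U, Matrix.conjTranspose_fromCols_eq_fromRows_conjTranspose, Matrix.fromRows_mul_fromCols,
    h11, h12, hF1, h21, Matrix.fromBlocks_one]

theorem IsNullBasis.U_mul_conjTranspose_U (hF : S.IsNullBasis F) (hm : S.h m ≠ 0) :
    S.U F m * (S.U F m)ᴴ = 1 := by
  have hN : N ≠ 0 := by
    rintro rfl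
    exact hm (Subsingleton.elim _ _)
  refine (Matrix.mul_eq_one_comm_of_card_eq _ _ _ ?_).mp (hF.conjTranspose_U_mul_U hm)
  simp only [Fintype.card_sum, Fintype.card_unit, Fintype.card_fin]
  omega

theorem rot_posSemidef (hX : (X m).PosSemidef) : (S.rot F X m).PosSemidef :=
  hX.conjTranspose_mul_mul_same _

theorem rot_eq_fromBlocks (hX : (X m).PosSemidef) :
    S.rot F X m = Matrix.fromBlocks (Matrix.of fun _ _ => (S.eta F X m : ℂ)) (S.xi F X m)ᴴ
      (S.xi F X m) (S.rot F X m).toBlocks₂₂ := by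
  have hR : (S.rot F X m).IsHermitian := (rot_posSemidef hX).isHermitian
  conv_lhs => rw [← Matrix.fromBlocks_toBlocks (S.rot F X m)]
  congr 1
  · ext i j
    exact (Complex.conj_eq_iff_re.mp (hR.apply (.inl ()) (.inl ()))).symm
  · ext i j
    exact (hR.apply (.inl i) (.inr j)).symm

theorem schur_eq_conj (hX : (X m).PosSemidef) (hη : 0 < S.eta F X m) :
    ∃ T : Matrix (Unit ⊕ Fin (N - 1)) (Fin (N - 1)) ℂ,
      S.schur F X m = Tᴴ * S.rot F X m * T := by
  let c : ℂ := (((S.eta F X m)⁻¹ : ℝ) : ℂ)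
  have hη' : (S.eta F X m : ℂ) ≠ 0 := by exact_mod_cast hη.ne'
  let T : Matrix (Unit ⊕ Fin (N - 1)) (Fin (N - 1)) ℂ :=
    Matrix.fromRows (-(c • (S.xi F X m)ᴴ)) 1
  have h1 : S.rot F X m * T = Matrix.fromRows 0 (S.schur F X m) := by
    rw [rot_eq_fromBlocks hX, Matrix.fromBlocks_mul_fromRows]
    congr 1
    · ext i j
      simp [Matrix.mul_apply, c, hη']
    · rw [schur]
      simp [c, sub_eq_neg_add]
  refine ⟨T, ?_⟩
  rw [Matrix.mul_assoc, h1, Matrix.conjTranspose_fromRows_eq_fromCols_conjTranspose,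
    Matrix.fromCols_mul_fromRows]
  simp

theorem schur_posSemidef (hX : (X m).PosSemidef) (hη : 0 < S.eta F X m) :
    (S.schur F X m).PosSemidef := by
  obtain ⟨T, hT⟩ := schur_eq_conj hX hη
  rw [hT]
  exact (rot_posSemidef hX).conjTranspose_mul_mul_same T

theorem rank_schur_le (hX : (X m).PosSemidef) (hη : 0 < S.eta F X m) :
    (S.schur F X m).rank ≤ (X m).rank := by
  obtain ⟨T, hT⟩ := schur_eq_conj hX hη
  rw [hT, rot]
  exact (Matrix.rank_mul_le_left _ _).trans ((Matrix.rank_mul_le_right _ _).trans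
    ((Matrix.rank_mul_le_left _ _).trans (Matrix.rank_mul_le_right _ _)))

theorem beam_eq_mul {K : ℕ} (S : Downlink N M L P)
    (F : Fin M → Matrix (Fin N) (Fin (N - 1)) ℂ) (X : Fin M → Matrix (Fin N) (Fin N) ℂ)
    (Om : Fin M → Matrix (Fin (N - 1)) (Fin (K - 1)) ℂ) (m : Fin M) :
    ∃ B : Matrix (Unit ⊕ Fin (N - 1)) (Unit ⊕ Fin (K - 1)) ℂ, S.beam F X Om m = S.U F m * B ∧
      B = Matrix.fromBlocks (Matrix.of fun _ _ => ((Real.sqrt (S.eta F X m) : ℝ) : ℂ)) 0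
        ((((Real.sqrt (S.eta F X m))⁻¹ : ℝ) : ℂ) • S.xi F X m) (Om m) :=
  ⟨_, rfl, rfl⟩

theorem cov_beam {K : ℕ} {Om : Fin M → Matrix (Fin (N - 1)) (Fin (K - 1)) ℂ}
    (hF : S.IsNullBasis F) (hm : S.h m ≠ 0) (hX : (X m).PosSemidef) (hη : 0 < S.eta F X m)
    (hOm : Om m * (Om m)ᴴ = S.schur F X m) : cov (S.beam F X Om) m = X m := by
  have hs : ((Real.sqrt (S.eta F X m) : ℝ) : ℂ) ≠ 0 := by
    exact_mod_cast (Real.sqrt_pos.mpr hη).ne'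
  have hs2 : ((Real.sqrt (S.eta F X m) : ℝ) : ℂ) * ((Real.sqrt (S.eta F X m) : ℝ) : ℂ) =
      (S.eta F X m : ℂ) := by
    rw [← Complex.ofReal_mul, Real.mul_self_sqrt hη.le]
  have h1 : ∀ B : Matrix (Unit ⊕ Fin (N - 1)) (Unit ⊕ Fin (K - 1)) ℂ,
      B * Bᴴ = S.rot F X m → S.U F m * B * (S.U F m * B)ᴴ = X m := by
    intro B hB
    have hU := hF.U_mul_conjTranspose_U hm
    rw [Matrix.conjTranspose_mul, Matrix.mul_assoc, ← Matrix.mul_assoc B, hB, rot]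
    calc _ = (S.U F m * (S.U F m)ᴴ) * X m * (S.U F m * (S.U F m)ᴴ) := by
          simp only [Matrix.mul_assoc]
      _ = X m := by rw [hU, Matrix.one_mul, Matrix.mul_one]
  obtain ⟨B, hbeam, hB⟩ := beam_eq_mul S F X Om m
  rw [cov, hbeam]
  refine h1 _ ?_
  rw [hB, rot_eq_fromBlocks hX, Matrix.fromBlocks_conjTranspose, Matrix.fromBlocks_multiply]
  congr 1
  · ext i j
    simp [Matrix.mul_apply, hs2]
  · ext i j
    simp [Matrix.mul_apply, hs]
  · ext i j
    simp only [Complex.ofReal_inv, Matrix.smul_mul, Matrix.conjTranspose_zero, Matrix.mul_zero,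
      add_zero, Matrix.smul_apply, smul_eq_mul, Matrix.mul_apply, Fintype.sum_unique,
      Matrix.conjTranspose_apply, Matrix.of_apply, Complex.star_def, Complex.conj_ofReal]
    field_simp
  · rw [hOm, schur, Matrix.conjTranspose_smul, Matrix.smul_mul, Matrix.mul_smul, smul_smul,
      Complex.star_def, Complex.conj_ofReal, ← Complex.ofReal_mul, ← mul_inv,
      Real.mul_self_sqrt hη.le]
    abel

theorem beam_orthogonal {K : ℕ} {Om : Fin M → Matrix (Fin (N - 1)) (Fin (K - 1)) ℂ}
    (hF : S.IsNullBasis F) (k : Fin (K - 1)) :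
    star (S.h m) ⬝ᵥ (S.beam F X Om m).col (Sum.inr k) = 0 := by
  have h1 : star (S.h m) ⬝ᵥ (S.beam F X Om m).col (Sum.inr k) =
      (star (S.h m) ᵥ* S.beam F X Om m) (Sum.inr k) := rfl
  have h2 : ∀ l, (star (S.h m) ᵥ* S.U F m) (Sum.inr l) = 0 := fun l => (hF m).2 l
  obtain ⟨B, hbeam, hB⟩ := beam_eq_mul S F X Om m
  rw [h1, hbeam, ← Matrix.vecMul_vecMul, Matrix.vecMul, dotProduct, Fintype.sum_sum_type, hB]
  simp [h2]

/-- An optimal solution of the relaxation whose Schur complements have small rank yields an optimal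
REEL-BF design. -/
theorem SDPOptimal.recovers {K : ℕ} (hX : S.SDPOptimal X)
    (hK : N ≤ K ∨ ∀ m, (X m).rank ≤ K - 1) : S.Recovers K X := by
  have hne := hX.1.h_ne_zero
  refine ⟨?_, fun F hF => ?_⟩
  · choose F hF using fun m => exists_orthonormal_complement (hne m)
    exact ⟨F, hF⟩
  have hη : ∀ m, 0 < S.eta F X m := by
    intro m
    rw [eta_eq]
    have h3 : ‖WithLp.toLp 2 (S.h m)‖ ≠ 0 := by
      rw [norm_ne_zero_iff]
      exact fun h => hne m (congrArg WithLp.ofLp h)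
    have := hX.1.ip_hh_pos m
    positivity
  have hrank : ∀ m, (S.schur F X m).rank ≤ K - 1 := by
    intro m
    rcases hK with hK | hK
    · have h := Matrix.rank_le_width (S.schur F X m)
      omega
    · exact (rank_schur_le (hX.1.1 m) (hη m)).trans (hK m)
  refine ⟨hη, hrank, ?_, fun Om hOm => ?_⟩
  · choose Om hOm using fun m =>
      exists_eq_mul_conjTranspose_of_rank_le (schur_posSemidef (hX.1.1 m) (hη m)) (hrank m)
    exact ⟨Om, hOm⟩
  · have hcov : cov (S.beam F X Om) = X :=
      funext fun m => cov_beam hF (hne m) (hX.1.1 m) (hη m) (hOm m)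
    have hfeas : S.REELFeasible K (S.beam F X Om) :=
      ⟨by rw [hcov]; exact hX.1.2, fun m k => beam_orthogonal hF k⟩
    refine ⟨⟨hfeas, fun W' hW' => ?_⟩, by rw [hcov], hfeas.gamma_le_sinr⟩
    rw [hcov]
    exact hX.2 _ hW'.sdpFeasible

end Recovery

end Downlink

end REELBF

namespace REELBF

theorem rank_lt_of_det_eq_zero {n : ℕ} {A : Matrix (Fin n) (Fin n) ℂ} (hA : A.IsHermitian)
    (hdet : A.det = 0) : A.rank < n := by
  rw [hA.det_eq_prod_eigenvalues, Finset.prod_eq_zero_iff] at hdet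
  obtain ⟨i, -, hi⟩ := hdet
  rw [hA.rank_eq_card_non_zero_eigs]
  have hi0 : hA.eigenvalues i = 0 := RCLike.ofReal_eq_zero.mp hi
  have h := Fintype.card_subtype_lt (p := fun i => hA.eigenvalues i ≠ 0) (x := i) (by simp [hi0])
  simpa using h

theorem ip_conj_diagonal {n : Type*} [Fintype n] {k : ℕ} (C : Matrix n n ℂ)
    (V : Matrix n (Fin k) ℂ) (d : Fin k → ℝ) :
    ip C (V * Matrix.diagonal (fun i => (d i : ℂ)) * Vᴴ) =
      ∑ i, d i * ip C (Matrix.vecMulVec (V.col i) (star (V.col i))) := by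
  have h1 : (C * (V * Matrix.diagonal (fun i => (d i : ℂ)) * Vᴴ)).trace =
      (Vᴴ * (C * V) * Matrix.diagonal (fun i => (d i : ℂ))).trace := by
    rw [← Matrix.mul_assoc, Matrix.trace_mul_comm]
    simp only [Matrix.mul_assoc]
  rw [ip, h1, Matrix.trace, Complex.re_sum]
  refine Finset.sum_congr rfl fun i _ => ?_
  rw [Matrix.diag_apply, Matrix.mul_diagonal, Complex.re_mul_ofReal, mul_comm, ip_vecMulVec_self]
  rfl

theorem conj_one_sub_smul {n k : Type*} [Fintype k] [DecidableEq k] {X : Matrix n n ℂ}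
    {V : Matrix n k ℂ} (hV : V * Vᴴ = X) (D : Matrix k k ℂ) (t : ℝ) :
    V * (1 - (t : ℂ) • D) * Vᴴ = X - (t : ℂ) • (V * D * Vᴴ) := by
  rw [Matrix.mul_sub, Matrix.sub_mul, Matrix.mul_one, hV, Matrix.mul_smul, Matrix.smul_mul]

theorem conj_one_sub {n k : Type*} [Fintype k] [DecidableEq k] {X : Matrix n n ℂ}
    {V : Matrix n k ℂ} (hV : V * Vᴴ = X) (D : Matrix k k ℂ) :
    V * (1 - D) * Vᴴ = X - ((1 : ℝ) : ℂ) • (V * D * Vᴴ) := by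
  simpa using conj_one_sub_smul hV D 1

namespace Downlink

variable {N M L P : ℕ} {S : Downlink N M L P}

/-- The individual constraints on user `m` belonging to group `p`. -/
def IndividualConstraint (S : Downlink N M L P) (p : Fin P) (m : Fin M)
    (X : Matrix (Fin N) (Fin N) ℂ) : Prop :=
  S.lower p m ≤ (ip (S.C p m) X : EReal) ∧ (ip (S.C p m) X : EReal) ≤ S.upper p m

/-- If one can move a little in both directions along `Z` from an optimal solution, then every
feasible point reached along `-Z` is optimal, since the power is affine. -/
theorem SDPOptimal.sub_smul {X Z : Fin M → Matrix (Fin N) (Fin N) ℂ} (hX : S.SDPOptimal X)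
    (hZ : ∀ᶠ t : ℝ in nhds 0, S.SDPFeasible fun m => X m - (t : ℂ) • Z m) {t : ℝ} (ht : 0 ≤ t)
    (hft : S.SDPFeasible fun m => X m - (t : ℂ) • Z m) :
    S.SDPOptimal fun m => X m - (t : ℂ) • Z m := by
  have hpow : ∀ s : ℝ, power (fun m => X m - (s : ℂ) • Z m) = power X - s * power Z := by
    intro s
    simp [power, Finset.mul_sum]
  obtain ⟨s, hs, hs0⟩ : ∃ s : ℝ, S.SDPFeasible (fun m => X m - (s : ℂ) • Z m) ∧ s < 0 :=
    ((hZ.filter_mono nhdsWithin_le_nhds).and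
      (self_mem_nhdsWithin : Set.Iio (0 : ℝ) ∈ nhdsWithin 0 (Set.Iio 0))).exists
  have h1 := hX.2 _ hs
  rw [hpow] at h1
  have h2 : 0 ≤ power Z := by
    by_contra! h
    nlinarith [mul_pos_of_neg_of_neg hs0 h]
  refine ⟨hft, fun X' hX' => le_trans ?_ (hX.2 X' hX')⟩
  rw [hpow]
  nlinarith [mul_nonneg ht h2]

section Direction

variable {X : Fin M → Matrix (Fin N) (Fin N) ℂ} {r : Fin M → ℕ}
  {V : ∀ m, Matrix (Fin N) (Fin (r m)) ℂ} {D : ∀ m, Matrix (Fin (r m)) (Fin (r m)) ℂ}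

theorem SDPFeasible.sub_smul (hX : S.SDPFeasible X) (hV : ∀ m, V m * (V m)ᴴ = X m)
    (hA : ∀ i, ∑ j, ip (S.A i j) (V j * D j * (V j)ᴴ) = 0) {t : ℝ}
    (hD : ∀ m, (1 - (t : ℂ) • D m).PosSemidef)
    (hC : ∀ p m, S.IndividualConstraint p m (X m - (t : ℂ) • (V m * D m * (V m)ᴴ))) :
    S.SDPFeasible fun m => X m - (t : ℂ) • (V m * D m * (V m)ᴴ) := by
  refine ⟨fun m => ?_, fun i => ?_, hC⟩
  · change (X m - (t : ℂ) • (V m * D m * (V m)ᴴ)).PosSemidef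
    rw [← conj_one_sub_smul (hV m)]
    exact (hD m).mul_mul_conjTranspose_same _
  · have h : ∑ j, ip (S.A i j) (X j - (t : ℂ) • (V j * D j * (V j)ᴴ)) =
        ∑ j, ip (S.A i j) (X j) := by
      simp only [ip_sub, ip_smul, Finset.sum_sub_distrib, ← Finset.mul_sum, hA, mul_zero,
        sub_zero]
    rw [h]
    exact hX.2.1 i

theorem SDPFeasible.eventually_sub_smul (hX : S.SDPFeasible X) (hV : ∀ m, V m * (V m)ᴴ = X m)
    (hDh : ∀ m, (D m).IsHermitian) (hA : ∀ i, ∑ j, ip (S.A i j) (V j * D j * (V j)ᴴ) = 0)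
    (hC : ∀ p m, ∀ᶠ t : ℝ in nhds 0,
      S.IndividualConstraint p m (X m - (t : ℂ) • (V m * D m * (V m)ᴴ))) :
    ∀ᶠ t : ℝ in nhds 0, S.SDPFeasible fun m => X m - (t : ℂ) • (V m * D m * (V m)ᴴ) := by
  have h1 : ∀ᶠ t : ℝ in nhds 0, ∀ m, (1 - (t : ℂ) • D m).PosSemidef :=
    Filter.eventually_all.mpr fun m => eventually_posSemidef_one_sub_smul (hDh m)
  have h2 := Filter.eventually_all.mpr fun p => Filter.eventually_all.mpr (hC p)
  filter_upwards [h1, h2] with t ht1 ht2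
  exact hX.sub_smul hV hA ht1 ht2

end Direction

theorem IsUpdate.sum_rank_lt {X X' : Fin M → Matrix (Fin N) (Fin N) ℂ}
    {V : ∀ m, Matrix (Fin N) (Fin (X m).rank) ℂ}
    {D : ∀ m, Matrix (Fin (X m).rank) (Fin (X m).rank) ℂ} (h : S.IsUpdate X X' V D) :
    ∑ m, (X' m).rank < ∑ m, (X m).rank := by
  obtain ⟨-, -, -, hpsd, ⟨m, hm⟩, hX'⟩ := h
  have hle : ∀ m, (X' m).rank ≤ (1 - D m).rank := by
    intro m
    rw [hX']
    exact (Matrix.rank_mul_le_left _ _).trans (Matrix.rank_mul_le_right _ _)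
  refine Finset.sum_lt_sum (fun m _ => (hle m).trans ?_) ⟨m, Finset.mem_univ m, (hle m).trans_lt ?_⟩
  · exact Matrix.rank_le_width _
  · exact rank_lt_of_det_eq_zero (hpsd m).isHermitian hm

theorem ReducesIn.cons {X X' X'' : Fin M → Matrix (Fin N) (Fin N) ℂ} {n : ℕ}
    (hX : S.SDPOptimal X) (h : S.GeneralStep X X' ∨ S.RankOneStep X X')
    (hred : S.ReducesIn n X' X'') : S.ReducesIn (n + 1) X X'' := by
  obtain ⟨Y, rfl, hYn, hopt, hstep⟩ := hred
  refine ⟨fun t => Nat.casesOn t X Y, rfl, hYn, fun t ht => ?_, fun t ht => ?_⟩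
  · cases t with
    | zero => exact hX
    | succ t => exact hopt t (by omega)
  · cases t with
    | zero => exact h
    | succ t => exact hstep t (by omega)

/-- Rank reduction terminates: every step decreases the total rank. -/
theorem exists_reducesIn (Q : (Fin M → Matrix (Fin N) (Fin N) ℂ) → Prop)
    (hQ : ∀ X, S.SDPOptimal X → ¬ Q X →
      ∃ X', S.SDPOptimal X' ∧ (S.GeneralStep X X' ∨ S.RankOneStep X X'))
    {X₀ : Fin M → Matrix (Fin N) (Fin N) ℂ} (hX₀ : S.SDPOptimal X₀) :
    ∃ n X, n ≤ M * N ∧ S.ReducesIn n X₀ X ∧ S.SDPOptimal X ∧ Q X := by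
  suffices h : ∀ R, ∀ X₀, S.SDPOptimal X₀ → ∑ m, (X₀ m).rank ≤ R →
      ∃ n X, n ≤ R ∧ S.ReducesIn n X₀ X ∧ S.SDPOptimal X ∧ Q X by
    refine h (M * N) X₀ hX₀ ((Finset.sum_le_sum fun m _ => Matrix.rank_le_width (X₀ m)).trans ?_)
    simp
  intro R
  induction R with
  | zero =>
    intro X₀ hX₀ hR
    by_cases hq : Q X₀
    · exact ⟨0, X₀, le_rfl, ⟨fun _ => X₀, rfl, rfl, fun _ _ => hX₀, by simp⟩, hX₀, hq⟩
    · obtain ⟨X', -, hs⟩ := hQ X₀ hX₀ hq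
      have hlt : ∑ m, (X' m).rank < ∑ m, (X₀ m).rank := by
        rcases hs with ⟨V, D, h, -⟩ | ⟨V, D, h, -⟩ <;> exact h.sum_rank_lt
      omega
  | succ R ih =>
    intro X₀ hX₀ hR
    by_cases hq : Q X₀
    · exact ⟨0, X₀, Nat.zero_le _, ⟨fun _ => X₀, rfl, rfl, fun _ _ => hX₀, by simp⟩, hX₀, hq⟩
    · obtain ⟨X', hX', hs⟩ := hQ X₀ hX₀ hq
      have hlt : ∑ m, (X' m).rank < ∑ m, (X₀ m).rank := by
        rcases hs with ⟨V, D, h, -⟩ | ⟨V, D, h, -⟩ <;> exact h.sum_rank_lt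
      obtain ⟨n, X, hn, hred, hX⟩ := ih X' hX' (by omega)
      exact ⟨n + 1, X, by omega, hred.cons hX₀ hs, hX⟩

/-- The coefficient matrices of the joint and of the individual constraints. -/
noncomputable def allCoeff (S : Downlink N M L P) :
    (Fin M ⊕ Fin L) ⊕ (Fin P × Fin M) → Fin M → Matrix (Fin N) (Fin N) ℂ
  | .inl i, j => S.A i j
  | .inr (p, m), j => if j = m then S.C p m else 0

theorem SDPOptimal.exists_generalStep {X : Fin M → Matrix (Fin N) (Fin N) ℂ}
    (hX : S.SDPOptimal X) (hr : M + L + P * M < ∑ m, (X m).rank ^ 2) :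
    ∃ X', S.SDPOptimal X' ∧ S.GeneralStep X X' := by
  choose V hV using fun m => exists_eq_mul_conjTranspose_of_rank_le (hX.1.1 m) le_rfl
  obtain ⟨D₀, hD₀h, hD₀, hΦ⟩ := exists_hermitian_map_eq_zero (congruenceMap S.allCoeff V)
    (by simpa using hr)
  obtain ⟨c, hpsd, hdet⟩ := exists_scaling hD₀h hD₀
  let D : ∀ m, Matrix (Fin (X m).rank) (Fin (X m).rank) ℂ := fun m => (c : ℂ) • D₀ m
  have hΦD : congruenceMap S.allCoeff V D = 0 := by
    have : D = c • D₀ := by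
      ext m i j
      simp [D]
    rw [this, map_smul, hΦ, smul_zero]
  have hDh : ∀ m, (D m).IsHermitian := fun m => by
    have h := (hD₀h m).eq
    simp only [D, Matrix.IsHermitian, Matrix.conjTranspose_smul, h, Complex.star_def,
      Complex.conj_ofReal]
  have hA : ∀ i, ∑ j, ip (S.A i j) (V j * D j * (V j)ᴴ) = 0 := fun i => congrFun hΦD (.inl i)
  have hC : ∀ p m, ip (S.C p m) (V m * D m * (V m)ᴴ) = 0 := by
    intro p m
    have h : ∑ j, ip (if j = m then S.C p m else 0) (V j * D j * (V j)ᴴ) = 0 :=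
      congrFun hΦD (.inr (p, m))
    rwa [Finset.sum_eq_single m (fun j _ hj => by simp [hj, ip]) (by simp), if_pos rfl] at h
  have hind : ∀ (t : ℝ) p m,
      S.IndividualConstraint p m (X m - (t : ℂ) • (V m * D m * (V m)ᴴ)) := by
    intro t p m
    rw [IndividualConstraint, ip_sub, ip_smul, hC, mul_zero, sub_zero]
    exact hX.1.2.2 p m
  refine ⟨fun m => X m - ((1 : ℝ) : ℂ) • (V m * D m * (V m)ᴴ), hX.sub_smul
    (hX.1.eventually_sub_smul hV hDh hA fun p m => Filter.Eventually.of_forall fun t => hind t p m)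
    zero_le_one (hX.1.sub_smul hV hA (fun m => ?_) (hind 1)), V, D,
    ⟨hV, hDh, hA, hpsd, hdet, fun m => (conj_one_sub (hV m) (D m)).symm⟩, hC⟩
  simpa [D] using hpsd m

theorem eventually_individualConstraint {p : Fin P} {m : Fin M} {X : ℝ → Matrix (Fin N) (Fin N) ℂ}
    {t : ℝ} (hX : Continuous X) (h1 : S.lower p m < (ip (S.C p m) (X t) : EReal))
    (h2 : (ip (S.C p m) (X t) : EReal) < S.upper p m) :
    ∀ᶠ s in nhds t, S.IndividualConstraint p m (X s) := by
  have hc : ContinuousAt (fun s => (ip (S.C p m) (X s) : EReal)) t :=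
    (continuous_coe_real_ereal.comp ((continuous_ip _).comp hX)).continuousAt
  filter_upwards [hc.eventually_mem (isOpen_Ioi.mem_nhds h1),
    hc.eventually_mem (isOpen_Iio.mem_nhds h2)] with s hs1 hs2
  exact ⟨le_of_lt hs1, le_of_lt hs2⟩

/-- An individual constraint that is inactive at optimality or homogeneous stays satisfied near an
optimal solution along a curve on which its value is scaled by nonnegative factors `φ s`. -/
theorem InactiveOrHomogeneous.eventually {X : ℝ → Fin M → Matrix (Fin N) (Fin N) ℂ}
    (hS : S.InactiveOrHomogeneous) {p : Fin P} {m : Fin M} {c : ℝ} {φ : ℝ → ℝ}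
    (hXc : Continuous fun s => X s m) (hφ : ∀ s, ip (S.C p m) (X s m) = φ s * c)
    {t : ℝ} (hX : S.SDPOptimal (X t)) (hc : S.lower p m = 0 → 0 ≤ c)
    (hc' : S.upper p m = 0 → c ≤ 0) {l : Filter ℝ} (hl : l ≤ nhds t) (hφl : ∀ᶠ s in l, 0 ≤ φ s) :
    ∀ᶠ s in l, S.IndividualConstraint p m (X s m) := by
  rcases hS p m with h | ⟨hlow, h⟩
  · exact hl (eventually_individualConstraint hXc (h _ hX).1 (h _ hX).2)
  · rcases h with hup | h
    · filter_upwards with s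
      rw [IndividualConstraint, hφ, le_antisymm (hc' hup) (hc hlow), hlow, hup]
      simp
    · have hcon : Continuous fun s => (ip (S.C p m) (X s m) : EReal) :=
        continuous_coe_real_ereal.comp ((continuous_ip _).comp hXc)
      filter_upwards [hφl, hl (hcon.continuousAt.eventually_mem
        (isOpen_Iio.mem_nhds (h _ hX)))] with s hs1 hs2
      refine ⟨?_, le_of_lt hs2⟩
      rw [hlow, hφ]
      exact_mod_cast mul_nonneg hs1 (hc hlow)

theorem SDPOptimal.exists_rankOneStep {S : Downlink N M L 2} (hS : S.InactiveOrHomogeneous)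
    {X : Fin M → Matrix (Fin N) (Fin N) ℂ}
    (hX : S.SDPOptimal X) (hr : M + L < ∑ m, (X m).rank) :
    ∃ X', S.SDPOptimal X' ∧ S.RankOneStep X X' := by
  choose V₀ hV₀ using fun m => exists_eq_mul_conjTranspose_of_rank_le (hX.1.1 m) le_rfl
  choose V hV hcol using fun m => exists_rankOne_decomposition (fun p => S.C_herm p m) (V₀ m)
  simp only [hV₀] at hV hcol
  obtain ⟨d₀, hd₀, hΦ⟩ := exists_diagonal_map_eq_zero (congruenceMap S.A V) (by simpa using hr)
  obtain ⟨c, hpsd, hdet⟩ := exists_scaling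
    (fun m => Matrix.isHermitian_diagonal_iff.mpr fun i => Complex.conj_ofReal (d₀ m i)) hd₀
  let d : ∀ m, Fin (X m).rank → ℝ := fun m i => c * d₀ m i
  let D : ∀ m, Matrix (Fin (X m).rank) (Fin (X m).rank) ℂ :=
    fun m => Matrix.diagonal fun i => (d m i : ℂ)
  have hD : ∀ m, D m = (c : ℂ) • Matrix.diagonal fun i => (d₀ m i : ℂ) := by
    intro m
    ext i j
    by_cases hij : i = j
    · subst hij; simp [D, d]
    · simp [D, hij]
  have hΦD : congruenceMap S.A V D = 0 := by
    have : D = c • fun m => Matrix.diagonal fun i => (d₀ m i : ℂ) := by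
      funext m
      rw [hD]
      rfl
    rw [this, map_smul, hΦ, smul_zero]
  have hDh : ∀ m, (D m).IsHermitian := fun m =>
    Matrix.isHermitian_diagonal_iff.mpr fun i => Complex.conj_ofReal (d m i)
  simp only [← hD] at hpsd hdet
  have hA : ∀ i, ∑ j, ip (S.A i j) (V j * D j * (V j)ᴴ) = 0 := fun i => congrFun hΦD i
  have hd1 : ∀ m i, d m i ≤ 1 := by
    intro m i
    have h := (Complex.nonneg_iff.mp ((hpsd m).diag_nonneg (i := i))).1
    simp only [D, Matrix.sub_apply, Matrix.one_apply_eq, Matrix.diagonal_apply_eq, Complex.sub_re,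
      Complex.one_re, Complex.ofReal_re] at h
    linarith
  let q : Fin M → ℝ := fun m => (∑ i, d m i) / (X m).rank
  have hq1 : ∀ m, q m ≤ 1 := by
    intro m
    refine div_le_one_of_le₀ ?_ (Nat.cast_nonneg _)
    refine (Finset.sum_le_sum fun i _ => hd1 m i).trans ?_
    simp
  let Y : ℝ → Fin M → Matrix (Fin N) (Fin N) ℂ := fun t m => X m - (t : ℂ) • (V m * D m * (V m)ᴴ)
  have hYc : ∀ m, Continuous fun t => Y t m := fun m =>
    continuous_const.sub (Complex.continuous_ofReal.smul continuous_const)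
  have hY0 : Y 0 = X := by
    funext m
    simp [Y]
  have hip : ∀ p m t, ip (S.C p m) (Y t m) = (1 - t * q m) * ip (S.C p m) (X m) := by
    intro p m t
    simp only [Y, D, q, ip_sub, ip_smul, ip_conj_diagonal, hcol, ← Finset.sum_mul]
    ring
  have hlow : ∀ p m, S.lower p m = 0 → 0 ≤ ip (S.C p m) (X m) := by
    intro p m h
    have := (hX.1.2.2 p m).1
    rw [h] at this
    exact_mod_cast this
  have hup : ∀ p m, S.upper p m = 0 → ip (S.C p m) (X m) ≤ 0 := by
    intro p m h
    have := (hX.1.2.2 p m).2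
    rw [h] at this
    exact_mod_cast this
  have hev : ∀ᶠ t : ℝ in nhds 0, S.SDPFeasible (Y t) := by
    refine hX.1.eventually_sub_smul hV hDh hA fun p m =>
      hS.eventually (X := Y) (hYc m) (hip p m) (t := 0) (by rwa [hY0]) (hlow p m) (hup p m) le_rfl ?_
    have hcont : Continuous fun t : ℝ => 1 - t * q m := by fun_prop
    filter_upwards [hcont.continuousAt.eventually_mem (isOpen_Ioi.mem_nhds
      (show (1 : ℝ) - 0 * q m ∈ Set.Ioi 0 by simp))] with t ht
    exact le_of_lt ht
  have hYcont : Continuous Y := continuous_pi hYc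
  have hsub : Set.Icc (0 : ℝ) 1 ⊆ {t | S.SDPFeasible (Y t)} := by
    refine IsClosed.Icc_subset_of_forall_mem_nhdsWithin
      ((S.isClosed_sdpFeasible.preimage hYcont).inter isClosed_Icc) hev.self_of_nhds ?_
    rintro t ⟨ht, ht0, ht1⟩
    have hopt : S.SDPOptimal (Y t) := hX.sub_smul hev ht0 ht
    have hIcc : ∀ᶠ s in nhdsWithin t (Set.Ioi t), 0 ≤ s ∧ s ≤ 1 := by
      filter_upwards [Ioo_mem_nhdsGT ht1] with s hs
      exact ⟨ht0.trans hs.1.le, hs.2.le⟩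
    have hind : ∀ᶠ s in nhdsWithin t (Set.Ioi t), ∀ p m, S.IndividualConstraint p m (Y s m) := by
      refine Filter.eventually_all.mpr fun p => Filter.eventually_all.mpr fun m =>
        hS.eventually (X := Y) (hYc m) (hip p m) hopt (hlow p m) (hup p m) nhdsWithin_le_nhds ?_
      filter_upwards [hIcc] with s hs
      nlinarith [mul_le_mul_of_nonneg_left (hq1 m) hs.1]
    filter_upwards [hIcc, hind] with s hs hs'
    exact hX.1.sub_smul hV hA (fun m => posSemidef_one_sub_smul (hpsd m) hs.1 hs.2) hs'
  refine ⟨Y 1, hX.sub_smul hev zero_le_one (hsub ⟨zero_le_one, le_rfl⟩), V, D,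
    ⟨hV, hDh, hA, hpsd, hdet, fun m => (conj_one_sub (hV m) (D m)).symm⟩,
    fun p m k => hcol m p k, fun m => Matrix.isDiag_diagonal _⟩

/-- In each of the three cases, finitely many rank reduction steps lead from an optimal solution of
the relaxation to one from which a REEL-BF design can be recovered. -/
theorem SDPOptimal.exists_reducesIn_recovers {S : Downlink N M L P} {K : ℕ}
    (hcond : N ≤ K ∨
      Real.sqrt (L + P * M + 1) + 2 ≤ (K : ℝ) ∨
      (P = 2 ∧ S.InactiveOrHomogeneous ∧
        min ((L : ℝ) + 3) (Real.sqrt (L + P * M + 1) + 2) ≤ (K : ℝ)))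
    {X₀ : Fin M → Matrix (Fin N) (Fin N) ℂ} (hX₀ : S.SDPOptimal X₀) :
    ∃ n X, n ≤ M * N ∧ (N ≤ K → n = 0) ∧ S.ReducesIn n X₀ X ∧ S.SDPOptimal X ∧
      S.Recovers K X := by
  by_cases hNK : N ≤ K
  · exact ⟨0, X₀, Nat.zero_le _, fun _ => rfl, ⟨fun _ => X₀, rfl, rfl, fun _ _ => hX₀, by simp⟩,
      hX₀, hX₀.recovers (Or.inl hNK)⟩
  have hcond' : Real.sqrt (L + P * M + 1) + 2 ≤ (K : ℝ) ∨
      (P = 2 ∧ S.InactiveOrHomogeneous ∧ L + 3 ≤ K) := by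
    rcases hcond with h | h | ⟨hP, hS, h⟩
    · exact absurd h hNK
    · exact Or.inl h
    · rcases min_le_iff.mp h with h | h
      · exact Or.inr ⟨hP, hS, by exact_mod_cast h⟩
      · exact Or.inl h
  have herase : ∀ m : Fin M, (Finset.univ.erase m).card + 1 = M := by
    intro m
    have := Finset.card_erase_add_one (Finset.mem_univ m)
    simpa using this
  rcases hcond' with h | ⟨rfl, hS, h⟩
  · obtain ⟨n, X, hn, hred, hX, hQ⟩ := exists_reducesIn (S := S)
      (fun X => ∑ m, (X m).rank ^ 2 ≤ M + L + P * M)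
      (fun X hX hq => by
        obtain ⟨X', hX', hs⟩ := hX.exists_generalStep (not_le.mp hq)
        exact ⟨X', hX', Or.inl hs⟩) hX₀
    refine ⟨n, X, hn, fun h => absurd h hNK, hred, hX, hX.recovers (Or.inr fun m => ?_)⟩
    rw [← Finset.add_sum_erase _ _ (Finset.mem_univ m)] at hQ
    have h1 : (Finset.univ.erase m).card ≤ ∑ j ∈ Finset.univ.erase m, (X j).rank ^ 2 := by
      rw [Finset.card_eq_sum_ones]
      exact Finset.sum_le_sum fun j _ => Nat.one_le_pow _ _ (hX.1.rank_pos j)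
    have h2 : (X m).rank ^ 2 ≤ L + P * M + 1 := by
      have := herase m
      omega
    have h3 : ((X m).rank : ℝ) ≤ Real.sqrt (L + P * M + 1) :=
      Real.le_sqrt_of_sq_le (by exact_mod_cast h2)
    have h4 : (X m).rank + 2 ≤ K := by
      have : ((X m).rank : ℝ) + 2 ≤ K := by linarith
      exact_mod_cast this
    omega
  · obtain ⟨n, X, hn, hred, hX, hQ⟩ := exists_reducesIn (S := S)
      (fun X => ∑ m, (X m).rank ≤ M + L)
      (fun X hX hq => by
        obtain ⟨X', hX', hs⟩ := hX.exists_rankOneStep hS (not_le.mp hq)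
        exact ⟨X', hX', Or.inr hs⟩) hX₀
    refine ⟨n, X, hn, fun h => absurd h hNK, hred, hX, hX.recovers (Or.inr fun m => ?_)⟩
    rw [← Finset.add_sum_erase _ _ (Finset.mem_univ m)] at hQ
    have h1 : (Finset.univ.erase m).card ≤ ∑ j ∈ Finset.univ.erase m, (X j).rank := by
      rw [Finset.card_eq_sum_ones]
      exact Finset.sum_le_sum fun j _ => hX.1.rank_pos j
    have := herase m
    omega

end Downlink

end REELBF

theorem theorem1 {N M L P : ℕ} (S : REELBF.Downlink N M L P) (K : ℕ) (hK : 1 ≤ K)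
    (hsolv : ∃ X, S.SDPFeasible X)
    (hcond : N ≤ K ∨
      Real.sqrt (L + P * M + 1) + 2 ≤ (K : ℝ) ∨
      (P = 2 ∧ S.InactiveOrHomogeneous ∧
        min ((L : ℝ) + 3) (Real.sqrt (L + P * M + 1) + 2) ≤ (K : ℝ))) :
    (∃ p : ℝ, IsLeast {q | ∃ X, S.SDPFeasible X ∧ REELBF.Downlink.power X = q} p ∧
      IsLeast {q | ∃ W, S.REELFeasible K W ∧ REELBF.Downlink.power (REELBF.Downlink.cov W) = q} p) ∧
    ∀ X₀, S.SDPOptimal X₀ →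
      ∃ n X, n ≤ M * N ∧ (N ≤ K → n = 0) ∧ S.ReducesIn n X₀ X ∧ S.SDPOptimal X ∧
        S.Recovers K X := by
  refine ⟨?_, fun X₀ hX₀ => hX₀.exists_reducesIn_recovers hcond⟩
  obtain ⟨X₀, hX₀⟩ := S.exists_sdpOptimal hsolv
  obtain ⟨-, X, -, -, -, hX, ⟨F, hF⟩, hrec⟩ := hX₀.exists_reducesIn_recovers hcond
  obtain ⟨-, -, ⟨Om, hOm⟩, hbeam⟩ := hrec F hF
  obtain ⟨hopt, hpow, -⟩ := hbeam Om hOm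
  refine ⟨REELBF.Downlink.power X, ⟨⟨X, hX.1, rfl⟩, ?_⟩, ⟨⟨_, hopt.1, hpow⟩, ?_⟩⟩
  · rintro _ ⟨X', hX', rfl⟩
    exact hX.2 X' hX'
  · rintro _ ⟨W, hW, rfl⟩
    rw [← hpow]
    exact hopt.2 W hW
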